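/- Let $\eta>0$. There is a constant $C>0$, depending only on $\eta$, such that the following holds for all $k,p,n,L,b\in\mathbb N$ with $b\ge 1$ and $n=Lb$, and all $M,H_p\ge 0$ and $\tau\in\mathbb R$. Let $\phi:\mathbb R^p\to\mathbb R$ be convex and differentiable with $\|\nabla\phi(x)-\nabla\phi(y)\|_2\le H_p\|x-y\|_2$ for all $x,y\in[-M,M]^p$, and let $d_\phi(x,y)=\phi(x)-\phi(y)-\langle\nabla\phi(y),x-y\rangle$ be its Bregman divergence. Let $\Psi:\mathbb R_{\ge0}^k\to\mathbb R_{\ge0}$ be componentwise non-decreasing with $\Psi(0)=0$ and $|\Psi(u)-\Psi(v)|\le\tau\|u-v\|_1$ for all $u,v\in\mathbb R^k_{\ge 0}$. For $\Theta=(\theta_1,\dots,\theta_k)\in\mathbb R^{k\times p}$ put $f_\Theta(x)=\Psi(d_\phi(x,\theta_1),\dots,d_\phi(x,\theta_k))$, and let $Pf_\Theta=\int f_\Theta\,dP$, where $P$ is a probability measure on $\mathbb R^p$ with $P([-M,M]^p)=1$. Let $X_1,\dots,X_n$ be $\mathbb R^p$-valued observations whose indices are split into inliers $\mathcal I$ and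 outliers $\mathcal O$: the variables $(X_i)_{i\in\mathcal I}$ are i.i.d. with law $P$, and nothing is assumed on $(X_i)_{i\in\mathcal O}$. Let $B_1,\dots,B_L$ be a (fixed) partition of $\{1,\dots,n\}$ into blocks of size $b$, assume $L>(2+\eta)|\mathcal O|$, and set $$\mathrm{MoM}^n_L(\Theta)=\mathrm{Median}\Big(\tfrac1b\sum_{i\in B_1}f_\Theta(X_i),\dots,\tfrac1b\sum_{i\in B_L}f_\Theta(X_i)\Big),\qquad \delta=\frac{2}{4+\eta}-\frac{|\mathcal O|}{L},$$ where the median of an even number of values is the average of the two middle ones. Let $\Theta^\ast$ be a minimizer of $\Theta\mapsto Pf_\Theta$ over $\mathbb R^{k\times p}$, and let $\widehat\Theta^{(\mathrm{MoM})}_n$ be a minimizer of $\mathrm{MoM}^n_L$ over $[-M,M]^{k\times p}$. Then, with probability at least $1-2e^{-2L\delta^2}$, $$\big|Pf_{\widehat\Theta^{(\mathrm{MoM})}_n}-Pf_{\Theta^\ast}\big|\le C\,M^2\,\tau\,H_p\,\max\Big\{kp\sqrt{\tfrac Ln},\ (kp)^{3/2}\,\frac{\sqrt{|\mathcal I|}}{n}\Big\}.$$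 -/

import Mathlib

open MeasureTheory ProbabilityTheory

noncomputable section

/-- The Bregman divergence `d_φ(x, y) = φ(x) - φ(y) - ⟨∇φ(y), x - y⟩` generated by `φ`. -/
def bregmanDiv {p : ℕ} (φ : EuclideanSpace ℝ (Fin p) → ℝ) (x y : EuclideanSpace ℝ (Fin p)) : ℝ :=
  φ x - φ y - inner ℝ (gradient φ y) (x - y)

/-- The loss `f_Θ(x) = Ψ(d_φ(x, θ₁), …, d_φ(x, θ_k))` of a point `x` for the centroids
`Θ = (θ₁, …, θ_k)`. Only the values of `Ψ` on the nonnegative orthant matter when `φ` is convex. -/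
def clusterLoss {k p : ℕ} (Ψ : (Fin k → ℝ) → ℝ) (φ : EuclideanSpace ℝ (Fin p) → ℝ)
    (Θ : Fin k → EuclideanSpace ℝ (Fin p)) (x : EuclideanSpace ℝ (Fin p)) : ℝ :=
  Ψ fun j => bregmanDiv φ x (Θ j)

/-- The risk `P f_Θ = ∫ f_Θ dP`. -/
def clusterRisk {k p : ℕ} (Ψ : (Fin k → ℝ) → ℝ) (φ : EuclideanSpace ℝ (Fin p) → ℝ)
    (P : Measure (EuclideanSpace ℝ (Fin p))) (Θ : Fin k → EuclideanSpace ℝ (Fin p)) : ℝ :=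
  ∫ x, clusterLoss Ψ φ Θ x ∂P

/-- The cube `[-M, M]^p`. -/
def cube (p : ℕ) (M : ℝ) : Set (EuclideanSpace ℝ (Fin p)) :=
  {x | ∀ i, x i ∈ Set.Icc (-M) M}

/-- The set `[-M, M]^{k × p}` of `k`-tuples of centroids in the cube. -/
def centroidCube (k p : ℕ) (M : ℝ) : Set (Fin k → EuclideanSpace ℝ (Fin p)) :=
  {Θ | ∀ j, Θ j ∈ cube p M}

/-- The median of `v₁, …, v_L`: if `v₍₀₎ ≤ … ≤ v₍L₋₁₎` are the sorted values, it is the average of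
those at positions `⌊(L-1)/2⌋` and `⌊L/2⌋` (which is the middle value if `L` is odd, and the
average of the two middle values if `L` is even). -/
def finMedian {L : ℕ} (v : Fin L → ℝ) : ℝ :=
  if h : 0 < L then
    (v (Tuple.sort v ⟨(L - 1) / 2, by omega⟩) + v (Tuple.sort v ⟨L / 2, by omega⟩)) / 2
  else 0

/-- The median-of-means objective: the median over the blocks `B₁, …, B_L` of the average loss
of the data points `x i` with index in the block. -/
def momObjective {k p n L : ℕ} (Ψ : (Fin k → ℝ) → ℝ) (φ : EuclideanSpace ℝ (Fin p) → ℝ)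
    (B : Fin L → Finset (Fin n)) (x : Fin n → EuclideanSpace ℝ (Fin p))
    (Θ : Fin k → EuclideanSpace ℝ (Fin p)) : ℝ :=
  finMedian fun ℓ => (∑ i ∈ B ℓ, clusterLoss Ψ φ Θ (x i)) / ((B ℓ).card : ℝ)

end

/-! A median can pass a level only if at least half of the block averages do. At most |O| of the
disjoint blocks contain an outlier, so it suffices that, simultaneously for all Θ in the cube and
for each of the two directions, fewer than L/2 - |O| clean blocks deviate from the risk by more than
ε. The median-of-means objective is then within ε of the risk on the whole cube, and its minimizer
is 2ε-optimal among centroids in the cube. Restricting to the cube loses nothing: Bregman projection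
of each centroid onto it decreases all divergences from points of the cube (`exists_bregmanDiv_le`),
hence the risk, as Ψ is monotone.

The number of bad clean blocks is dominated by a sum of Lipschitz ramps, `badCount`. Its supremum
over a net changes by at most one when one block changes, so McDiarmid's inequality bounds its
excess over its mean by Lδ outside an event of probability e^{-2Lδ²}; the two directions give the
factor 2. The mean of the supremum has two parts: the mean of a single count, controlled by the
first absolute moment of a block average (`badMean_le`), and the supremum of the centered counts,
controlled by chaining along dyadic nets (`integral_sup'_badCount_centered_le`). The chaining
increments are sub-Gaussian because bounds on the mean of cosh survive contractions
(`integral_exp_centered_le`).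

With K = 4τHM²kp, which is both the envelope of the loss and the scale of the nets, the two parts
correspond to the two branches of the maximum in the rate. `rate_bound` checks that ε, a multiple of
the rate, makes their sum at most Lκ, where κ + δ = 1/2 - |O|/L. -/

/-! ### Exponential moments of bounded functions -/

section Moments

variable {α : Type*} [MeasurableSpace α] {μ : Measure α} [IsProbabilityMeasure μ]

lemma integrable_of_abs_le {f : α → ℝ} (hf : Measurable f) {K : ℝ} (hK : ∀ x, |f x| ≤ K) :
    Integrable f μ :=
  Integrable.of_bound hf.aestronglyMeasurable K (ae_of_all _ hK)

lemma integrable_exp_of_abs_le {f : α → ℝ} (hf : Measurable f) {K : ℝ} (hK : ∀ x, |f x| ≤ K)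
    (t : ℝ) : Integrable (fun x => Real.exp (t * f x)) μ := by
  refine integrable_of_abs_le (by fun_prop) (K := Real.exp (|t| * K)) fun x => ?_
  rw [Real.abs_exp, Real.exp_le_exp]
  calc t * f x ≤ |t * f x| := le_abs_self _
    _ = |t| * |f x| := abs_mul _ _
    _ ≤ _ := mul_le_mul_of_nonneg_left (hK x) (abs_nonneg t)

lemma integrable_cosh_of_abs_le {f : α → ℝ} (hf : Measurable f) {K : ℝ} (hK : ∀ x, |f x| ≤ K)
    (t : ℝ) : Integrable (fun x => Real.cosh (t * f x)) μ := by
  simp_rw [Real.cosh_eq, ← neg_mul]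
  exact ((integrable_exp_of_abs_le hf hK t).add (integrable_exp_of_abs_le hf hK (-t))).div_const 2

lemma abs_integral_le_of_abs_le {f : α → ℝ} {K : ℝ} (hK : ∀ x, |f x| ≤ K) :
    |∫ x, f x ∂μ| ≤ K := by
  simpa using norm_integral_le_of_norm_le_const (μ := μ) (f := f) (C := K) (ae_of_all _ hK)

/-- A function dominated by a sub-Gaussian one is sub-Gaussian after centering. -/
lemma integral_exp_centered_le {w V : α → ℝ} (hw : Measurable w) (hV : Measurable V) {K s : ℝ}
    (hwV : ∀ x, |w x| ≤ |V x|) (hK : ∀ x, |V x| ≤ K)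
    (hs : ∀ t : ℝ, ∫ x, Real.cosh (t * V x) ∂μ ≤ Real.exp (t ^ 2 * s / 2)) (t : ℝ) :
    ∫ x, Real.exp (t * (w x - ∫ y, w y ∂μ)) ∂μ ≤ Real.exp (t ^ 2 * s) := by
  have hwK : ∀ x, |w x| ≤ K := fun x => (hwV x).trans (hK x)
  set m := ∫ y, w y ∂μ with hm
  -- Domination in absolute value passes through cosh, which is even and increasing in |·|; it would
  -- not pass through exp.
  have hcosh : ∫ x, Real.cosh (t * w x) ∂μ ≤ Real.exp (t ^ 2 * s / 2) := by
    refine (integral_mono (integrable_cosh_of_abs_le hw hwK t)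
      (integrable_cosh_of_abs_le hV hK t) fun x => ?_).trans (hs t)
    refine Real.cosh_le_cosh.2 ?_
    rw [abs_mul, abs_mul]
    exact mul_le_mul_of_nonneg_left (hwV x) (abs_nonneg t)
  have hsplit : ∀ r : ℝ, ∫ x, Real.exp (r * (w x - m)) ∂μ
      = Real.exp (-(r * m)) * ∫ x, Real.exp (r * w x) ∂μ := by
    intro r
    rw [← integral_const_mul]
    refine integral_congr_ae (ae_of_all _ fun x => ?_)
    simp only [← Real.exp_add]
    ring_nf
  -- Jensen's inequality. Multiplying by this factor, as for an independent copy, cancels the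
  -- centering and leaves A * B, which AM-GM bounds by the squared mean of cosh.
  have hneg : 1 ≤ ∫ x, Real.exp (-t * (w x - m)) ∂μ := by
    have h1 : ∫ x, (1 + -t * (w x - m)) ∂μ = 1 := by
      have hi : Integrable (fun x => w x - m) μ :=
        (integrable_of_abs_le hw hwK).sub (integrable_const m)
      rw [integral_add (integrable_const _) (hi.const_mul _), integral_const_mul,
        integral_sub (integrable_of_abs_le hw hwK) (integrable_const m)]
      simp [hm]
    rw [← h1]
    refine integral_mono ?_ ?_ fun x => ?_
    · exact (integrable_const _).add
        (((integrable_of_abs_le hw hwK).sub (integrable_const m)).const_mul _)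
    · refine integrable_exp_of_abs_le (K := K + |m|) (by fun_prop) (fun x => ?_) _
      exact (abs_sub _ _).trans (add_le_add (hwK x) le_rfl)
    · linarith [Real.add_one_le_exp (-t * (w x - m))]
  set A := ∫ x, Real.exp (t * w x) ∂μ with hA
  set B := ∫ x, Real.exp (-t * w x) ∂μ with hB
  have hAB : (A + B) / 2 = ∫ x, Real.cosh (t * w x) ∂μ := by
    simp_rw [Real.cosh_eq, ← neg_mul]
    rw [integral_div, integral_add (integrable_exp_of_abs_le hw hwK t)
      (integrable_exp_of_abs_le hw hwK (-t))]
  have hA0 : 0 ≤ A := integral_nonneg fun x => (Real.exp_pos _).le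
  have hB0 : 0 ≤ B := integral_nonneg fun x => (Real.exp_pos _).le
  have hpos : 0 ≤ ∫ x, Real.exp (t * (w x - m)) ∂μ := integral_nonneg fun x => (Real.exp_pos _).le
  calc ∫ x, Real.exp (t * (w x - m)) ∂μ
      ≤ (∫ x, Real.exp (t * (w x - m)) ∂μ) * ∫ x, Real.exp (-t * (w x - m)) ∂μ :=
        le_mul_of_one_le_right hpos hneg
    _ = A * B := by
        rw [hsplit, hsplit, ← hA, ← hB, mul_mul_mul_comm, ← Real.exp_add]
        simp
    _ ≤ ((A + B) / 2) ^ 2 := by nlinarith [sq_nonneg (A - B)]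
    _ ≤ (Real.exp (t ^ 2 * s / 2)) ^ 2 := by
        refine pow_le_pow_left₀ (by positivity) ?_ 2
        rw [hAB]; exact hcosh
    _ = Real.exp (t ^ 2 * s) := by
        rw [← Real.exp_nat_mul]; ring_nf

/-- The first absolute moment of a sub-Gaussian function. -/
lemma integral_abs_le_of_cosh {V : α → ℝ} (hV : Measurable V) {K s : ℝ} (hs0 : 0 < s)
    (hK : ∀ x, |V x| ≤ K)
    (hs : ∀ t : ℝ, ∫ x, Real.cosh (t * V x) ∂μ ≤ Real.exp (t ^ 2 * s / 2)) :
    ∫ x, |V x| ∂μ ≤ 2 * √s := by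
  have hq : 0 < √s := Real.sqrt_pos.2 hs0
  have h1 : ∫ x, (√s)⁻¹ * |V x| ∂μ ≤ ∫ x, Real.cosh ((√s)⁻¹ * V x) ∂μ := by
    refine integral_mono ((integrable_of_abs_le hV hK).abs.const_mul _)
      (integrable_cosh_of_abs_le hV hK _) fun x => ?_
    have : (√s)⁻¹ * |V x| = |(√s)⁻¹ * V x| := by
      rw [abs_mul, abs_of_pos (inv_pos.2 hq)]
    simp only [this]
    rw [← Real.cosh_abs]
    set y := |(√s)⁻¹ * V x|
    -- Averaging e^y ≥ 1 + y + y²/2 and e^{-y} ≥ 1 - y gives cosh y ≥ 1 + y²/4 ≥ y.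
    have h2 := Real.quadratic_le_exp_of_nonneg (abs_nonneg ((√s)⁻¹ * V x))
    have h3 := Real.add_one_le_exp (-y)
    rw [Real.cosh_eq]
    nlinarith [sq_nonneg (y - 2)]
  rw [integral_const_mul] at h1
  have h2 := h1.trans (hs (√s)⁻¹)
  have h3 : ((√s)⁻¹) ^ 2 * s / 2 = 1 / 2 := by
    rw [inv_pow, Real.sq_sqrt hs0.le, inv_mul_cancel₀ hs0.ne']
  have h4 : Real.exp (1 / 2) ≤ 2 := by
    have := Real.exp_one_lt_d9
    have h5 : Real.exp (1 / 2) ^ 2 = Real.exp 1 := by rw [← Real.exp_nat_mul]; norm_num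
    nlinarith [Real.exp_pos (1 / 2)]
  rw [h3] at h2
  rw [inv_mul_le_iff₀ hq] at h2
  nlinarith

/-- The expectation of the maximum of finitely many sub-Gaussian functions. -/
lemma integral_sup'_le {T : Type*} {S : Finset T} (hS : S.Nonempty) {Z : T → α → ℝ}
    (hZ : ∀ t, Measurable (Z t)) {K : ℝ} (hK : ∀ t x, |Z t x| ≤ K) {r s N : ℝ} (hr : 0 < r)
    (hN : Real.log S.card ≤ N)
    (hs : ∀ t ∈ S, ∫ x, Real.exp (r * Z t x) ∂μ ≤ Real.exp (r ^ 2 * s / 2)) :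
    ∫ x, S.sup' hS (fun t => Z t x) ∂μ ≤ N / r + r * s / 2 := by
  have hcard : (0 : ℝ) < S.card := by exact_mod_cast hS.card_pos
  -- The point of tangency: rZ ≤ e^{rZ - a} + a - 1. Summing over the net, this `a` makes the mean
  -- of the exponential term at most 1, so no logarithm of an expectation is needed.
  set a := N + r ^ 2 * s / 2 with ha
  have hmeas : Measurable fun x => S.sup' hS (fun t => Z t x) := by
    have := Finset.measurable_sup' hS (fun t _ => hZ t)
    convert this using 2 with x
    simp [Finset.sup'_apply]
  have hbd : ∀ x, |S.sup' hS (fun t => Z t x)| ≤ K := by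
    intro x
    obtain ⟨t, _, ht⟩ := S.exists_mem_eq_sup' hS (fun t => Z t x)
    rw [ht]; exact hK t x
  have hint : ∀ t, Integrable (fun x => Real.exp (r * Z t x)) μ :=
    fun t => integrable_exp_of_abs_le (hZ t) (hK t) r
  have h1 : ∫ x, r * S.sup' hS (fun t => Z t x) ∂μ
      ≤ ∫ x, (Real.exp (-a) * ∑ t ∈ S, Real.exp (r * Z t x) + (a - 1)) ∂μ := by
    refine integral_mono ((integrable_of_abs_le hmeas hbd).const_mul _)
      (((integrable_finsetSum _ fun t _ => hint t).const_mul _).add (integrable_const _))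
      fun x => ?_
    obtain ⟨t, htS, ht⟩ := S.exists_mem_eq_sup' hS (fun t => Z t x)
    simp only [ht]
    have h2 : Real.exp (r * Z t x) ≤ ∑ t ∈ S, Real.exp (r * Z t x) :=
      Finset.single_le_sum (f := fun t => Real.exp (r * Z t x))
        (fun _ _ => (Real.exp_pos _).le) htS
    have h3 := Real.add_one_le_exp (-a + r * Z t x)
    rw [Real.exp_add] at h3
    have h4 := mul_le_mul_of_nonneg_left h2 (Real.exp_pos (-a)).le
    linarith
  rw [integral_const_mul, integral_add
    ((integrable_finsetSum _ fun t _ => hint t).const_mul _) (integrable_const _),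
    integral_const_mul, integral_finsetSum _ fun t _ => hint t] at h1
  have h5 : Real.exp (-a) * ∑ t ∈ S, ∫ x, Real.exp (r * Z t x) ∂μ ≤ 1 := by
    calc Real.exp (-a) * ∑ t ∈ S, ∫ x, Real.exp (r * Z t x) ∂μ
        ≤ Real.exp (-a) * ∑ t ∈ S, Real.exp (r ^ 2 * s / 2) := by
          gcongr with t ht; exact hs t ht
      _ = Real.exp (-N) * S.card := by
          rw [Finset.sum_const, nsmul_eq_mul, mul_left_comm, ← Real.exp_add, mul_comm]
          congr 2; rw [ha]; ring
      _ ≤ Real.exp (-N) * Real.exp N := by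
          gcongr; rw [← Real.log_le_iff_le_exp hcard]; exact hN
      _ = 1 := by rw [← Real.exp_add]; simp
  have h6 : r * ∫ x, S.sup' hS (fun t => Z t x) ∂μ ≤ a := by
    have h7 : ∫ _x, (a - 1) ∂μ = a - 1 := by simp
    linarith
  rw [mul_comm, ← le_div_iff₀ hr] at h6
  refine h6.trans (le_of_eq ?_)
  rw [ha]; field_simp

end Moments

/-! ### Product measures -/

section Product

variable {α : Type*} [MeasurableSpace α] {ν : Measure α} [IsProbabilityMeasure ν]

/-- Exponential moments of a sum of independent copies. -/
lemma integral_exp_sum_pi (n : ℕ) (w : α → ℝ) (t : ℝ) :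
    ∫ x : Fin n → α, Real.exp (t * ∑ l, w (x l)) ∂(Measure.pi fun _ => ν)
      = (∫ y, Real.exp (t * w y) ∂ν) ^ n := by
  have := integral_fintype_prod_eq_prod (𝕜 := ℝ) (ι := Fin n) (μ := fun _ => ν)
    (fun _ y => Real.exp (t * w y))
  simp only [Finset.prod_const, Finset.card_univ, Fintype.card_fin] at this
  rw [← this]
  refine integral_congr_ae (ae_of_all _ fun x => ?_)
  simp only [Finset.mul_sum, Real.exp_sum]

/-- **Hoeffding's lemma** for a function of oscillation at most one. -/
lemma integral_exp_le_of_oscillation {h : α → ℝ} (hh : Measurable h)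
    (hosc : ∀ x y, |h x - h y| ≤ 1) (t : ℝ) :
    ∫ x, Real.exp (t * (h x - ∫ y, h y ∂ν)) ∂ν ≤ Real.exp (t ^ 2 / 8) := by
  obtain ⟨x₀⟩ : Nonempty α := nonempty_of_isProbabilityMeasure ν
  have hbb : BddBelow (Set.range h) := by
    refine ⟨h x₀ - 1, ?_⟩
    rintro _ ⟨y, rfl⟩
    linarith [(abs_le.1 (hosc x₀ y)).2]
  have hmem : ∀ x, h x ∈ Set.Icc (⨅ y, h y) ((⨅ y, h y) + 1) := by
    intro x
    have : Nonempty α := ⟨x₀⟩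
    refine ⟨ciInf_le hbb x, ?_⟩
    have : h x - 1 ≤ ⨅ y, h y := le_ciInf fun y => by linarith [(abs_le.1 (hosc x y)).2]
    linarith
  have := (hasSubgaussianMGF_of_mem_Icc hh.aemeasurable (ae_of_all ν hmem)).mgf_le t
  refine this.trans (Real.exp_le_exp.2 (le_of_eq ?_))
  push_cast
  rw [add_sub_cancel_left]
  norm_num
  ring

/-- **McDiarmid's inequality**, as a bound on exponential moments. -/
lemma integral_exp_le_of_bounded_differences (n : ℕ) {f : (Fin n → α) → ℝ} (hf : Measurable f)
    {K : ℝ} (hK : ∀ x, |f x| ≤ K)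
    (hd : ∀ x i y, |f (Function.update x i y) - f x| ≤ 1) (t : ℝ) :
    ∫ x, Real.exp (t * (f x - ∫ y, f y ∂(Measure.pi fun _ => ν))) ∂(Measure.pi fun _ => ν)
      ≤ Real.exp (t ^ 2 * n / 8) := by
  induction n with
  | zero =>
    have : ∀ x, f x = f default := fun x => congrArg f (Subsingleton.elim _ _)
    simp_rw [this]
    simp
  | succ n ih =>
    let ρ : Measure (Fin n → α) := Measure.pi fun _ => ν
    let e := (MeasurableEquiv.piFinSuccAbove (fun _ : Fin (n + 1) => α) 0).symm
    have hmp : MeasurePreserving e (ν.prod ρ) (Measure.pi fun _ => ν) :=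
      (measurePreserving_piFinSuccAbove (fun _ : Fin (n + 1) => ν) 0).symm
    have he : ∀ y z, e (y, z) = Fin.cons y z := fun y z => by
      simp [e, MeasurableEquiv.piFinSuccAbove, Fin.insertNthEquiv]
    have hc : Measurable fun q : α × (Fin n → α) => f (Fin.cons q.1 q.2) := by
      have := hf.comp e.measurable
      convert this using 2 with q
      simp [← he]
    have hint : ∀ F : (Fin (n + 1) → α) → ℝ, ∫ x, F x ∂(Measure.pi fun _ => ν)
        = ∫ q, F (Fin.cons q.1 q.2) ∂(ν.prod ρ) := by
      intro F
      rw [← hmp.integral_comp e.measurableEmbedding]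
      exact integral_congr_ae (ae_of_all _ fun q => by simp only [← he])
    -- Split f - m into f - h, handled by induction for each fixed first coordinate, and h - m,
    -- handled by Hoeffding's lemma.
    set h : α → ℝ := fun y => ∫ z, f (Fin.cons y z) ∂ρ with hh
    have hhm : Measurable h := by
      have : StronglyMeasurable (Function.uncurry fun (y : α) (z : Fin n → α) =>
        f (Fin.cons y z)) := hc.stronglyMeasurable
      exact this.integral_prod_right.measurable
    have hcy : ∀ y, Measurable fun z : Fin n → α => f (Fin.cons y z) := fun y =>
      hc.comp (measurable_const.prodMk measurable_id)
    have hm : ∫ x, f x ∂(Measure.pi fun _ => ν) = ∫ y, h y ∂ν := by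
      rw [hint, integral_prod _ (integrable_of_abs_le hc fun q => hK _)]
    have hosc : ∀ x y, |h x - h y| ≤ 1 := by
      intro x y
      rw [hh]
      simp only
      rw [← integral_sub (integrable_of_abs_le (hcy x) fun z => hK _)
        (integrable_of_abs_le (hcy y) fun z => hK _)]
      refine abs_integral_le_of_abs_le fun z => ?_
      have := hd (Fin.cons y z : Fin (n + 1) → α) 0 x
      rwa [Fin.update_cons_zero] at this
    have hinner : ∀ y, ∫ z, Real.exp (t * (f (Fin.cons y z) - h y)) ∂ρ
        ≤ Real.exp (t ^ 2 * n / 8) := fun y => by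
      refine ih (hcy y) (fun z => hK _) fun z i v => ?_
      have := hd (Fin.cons y z : Fin (n + 1) → α) i.succ v
      rwa [← Fin.cons_update] at this
    rw [hm, hint]
    set m := ∫ y, h y ∂ν
    have hhK : ∀ y, |h y| ≤ K := fun y => abs_integral_le_of_abs_le fun z => hK _
    have hie : Integrable (fun q : α × (Fin n → α) => Real.exp (t * (f (Fin.cons q.1 q.2) - m)))
        (ν.prod ρ) :=
      integrable_exp_of_abs_le (K := K + |m|) (hc.sub_const m)
        (fun q => (abs_sub _ _).trans (add_le_add (hK _) le_rfl)) t
    rw [integral_prod _ hie]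
    have hih : Integrable (fun y => Real.exp (t * (h y - m))) ν :=
      integrable_exp_of_abs_le (K := K + |m|) (by fun_prop)
        (fun q => (abs_sub _ _).trans (add_le_add (hhK _) le_rfl)) t
    calc ∫ y, ∫ z, Real.exp (t * (f (Fin.cons y z) - m)) ∂ρ ∂ν
        ≤ ∫ y, Real.exp (t ^ 2 * n / 8) * Real.exp (t * (h y - m)) ∂ν := by
          refine integral_mono hie.integral_prod_left (hih.const_mul _) fun y => ?_
          have h1 : ∫ z, Real.exp (t * (f (Fin.cons y z) - m)) ∂ρ
              = (∫ z, Real.exp (t * (f (Fin.cons y z) - h y)) ∂ρ) * Real.exp (t * (h y - m)) := by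
            rw [← integral_mul_const]
            refine integral_congr_ae (ae_of_all _ fun z => ?_)
            simp only [← Real.exp_add]
            ring_nf
          simp only [h1]
          exact mul_le_mul_of_nonneg_right (hinner y) (Real.exp_pos _).le
      _ = Real.exp (t ^ 2 * n / 8) * ∫ y, Real.exp (t * (h y - m)) ∂ν := integral_const_mul _ _
      _ ≤ Real.exp (t ^ 2 * n / 8) * Real.exp (t ^ 2 / 8) :=
          mul_le_mul_of_nonneg_left (integral_exp_le_of_oscillation hhm hosc t) (Real.exp_pos _).le
      _ = Real.exp (t ^ 2 * (n + 1 : ℕ) / 8) := by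
          rw [← Real.exp_add]; push_cast; ring_nf

/-- **McDiarmid's inequality**: the upper tail, for at most `N` coordinates. -/
lemma measureReal_ge_le_of_bounded_differences {n : ℕ} {f : (Fin n → α) → ℝ} (hf : Measurable f)
    {K : ℝ} (hK : ∀ x, |f x| ≤ K)
    (hd : ∀ x i y, |f (Function.update x i y) - f x| ≤ 1) {N δ c : ℝ} (hn : n ≤ N) (hδ : 0 ≤ δ)
    (hc : ∫ y, f y ∂(Measure.pi fun _ => ν) ≤ c) :
    (Measure.pi fun _ => ν).real {x | c + N * δ ≤ f x} ≤ Real.exp (-2 * N * δ ^ 2) := by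
  set m := ∫ y, f y ∂(Measure.pi fun _ : Fin n => ν)
  have hfm : Measurable fun x => f x - m := by fun_prop
  -- The Chernoff parameter 4δ gives the exponent -4Nδ² + 2nδ², at most -2Nδ² since n ≤ N.
  have h1 := measure_ge_le_exp_mul_mgf (μ := Measure.pi fun _ : Fin n => ν)
    (X := fun x => f x - m) (t := 4 * δ) (N * δ) (by positivity)
    (integrable_exp_of_abs_le (K := K + |m|) hfm
      (fun q => (abs_sub _ _).trans (add_le_add (hK _) le_rfl)) _)
  have h2 : {x | c + N * δ ≤ f x} ⊆ {x | N * δ ≤ f x - m} := fun x hx => by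
    simp only [Set.mem_ofPred_eq] at hx ⊢; linarith
  refine (measureReal_mono h2).trans (h1.trans ?_)
  have h3 := integral_exp_le_of_bounded_differences (ν := ν) n hf hK hd (4 * δ)
  refine (mul_le_mul_of_nonneg_left h3 (Real.exp_pos _).le).trans ?_
  rw [← Real.exp_add, Real.exp_le_exp]
  nlinarith [mul_le_mul_of_nonneg_left hn (sq_nonneg δ)]

end Product

/-! ### Block averages -/

section Block

variable {E : Type*} [MeasurableSpace E]

/-- The deviation of the average of `g` over a block of `b` points from the mean of `g`. -/
noncomputable def blockDev (P : Measure E) {b : ℕ} (g : E → ℝ) (z : Fin b → E) : ℝ :=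
  (∑ i, g (z i)) / b - ∫ x, g x ∂P

variable {P : Measure E} {b : ℕ}

lemma measurable_blockDev {g : E → ℝ} (hg : Measurable g) :
    Measurable (blockDev P (b := b) g) := by
  unfold blockDev; fun_prop

lemma blockDev_sub {g h : E → ℝ} (hg : Integrable g P) (hh : Integrable h P) (z : Fin b → E) :
    blockDev P g z - blockDev P h z = blockDev P (fun x => g x - h x) z := by
  unfold blockDev
  rw [integral_sub hg hh, Finset.sum_sub_distrib]
  ring

variable [IsProbabilityMeasure P]

lemma abs_blockDev_le (hb : 0 < b) {g : E → ℝ} {a : ℝ} (ha : ∀ x, |g x| ≤ a) (z : Fin b → E) :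
    |blockDev P g z| ≤ 2 * a := by
  have hb' : (0 : ℝ) < b := by exact_mod_cast hb
  have h1 : |(∑ i, g (z i)) / b| ≤ a := by
    rw [abs_div, abs_of_pos hb', div_le_iff₀ hb']
    refine (Finset.abs_sum_le_sum_abs _ _).trans ?_
    refine (Finset.sum_le_sum fun i _ => ha (z i)).trans (le_of_eq ?_)
    simp [mul_comm]
  have h2 : |∫ x, g x ∂P| ≤ a := abs_integral_le_of_abs_le ha
  unfold blockDev
  exact (abs_sub _ _).trans (by linarith)

/-- Hoeffding's lemma on [-a, a] gives variance proxy a² per point, and averaging b independent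
points divides it by b. The cosh form is the one that survives composition with the ramp. -/
lemma integral_cosh_blockDev_le (hb : 0 < b) {g : E → ℝ} (hg : Measurable g) {a : ℝ}
    (ha : ∀ x, |g x| ≤ a) (t : ℝ) :
    ∫ z : Fin b → E, Real.cosh (t * blockDev P g z) ∂(Measure.pi fun _ => P)
      ≤ Real.exp (t ^ 2 * (a ^ 2 / b) / 2) := by
  have hb' : (0 : ℝ) < b := by exact_mod_cast hb
  set m := ∫ x, g x ∂P with hm
  have hH := hasSubgaussianMGF_of_mem_Icc hg.aemeasurable (ae_of_all P fun x => abs_le.1 (ha x))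
  have hexp : ∀ r : ℝ, ∫ z : Fin b → E, Real.exp (r * blockDev P g z) ∂(Measure.pi fun _ => P)
      ≤ Real.exp (r ^ 2 * (a ^ 2 / b) / 2) := by
    intro r
    have h1 : ∀ z : Fin b → E, r * blockDev P g z = (r / b) * ∑ i, (g (z i) - m) := by
      intro z
      unfold blockDev
      rw [Finset.sum_sub_distrib, ← hm]
      simp
      field_simp
    simp_rw [h1]
    rw [integral_exp_sum_pi b (fun y => g y - m)]
    have h2 : ∫ y, Real.exp (r / b * (g y - m)) ∂P ≤ Real.exp (a ^ 2 * (r / b) ^ 2 / 2) := by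
      refine (hH.mgf_le (r / b)).trans (Real.exp_le_exp.2 (le_of_eq ?_))
      push_cast
      rw [Real.norm_eq_abs, div_pow, sq_abs]
      ring
    refine (pow_le_pow_left₀ (integral_nonneg fun _ => (Real.exp_pos _).le) h2 b).trans ?_
    rw [← Real.exp_nat_mul, Real.exp_le_exp]
    refine le_of_eq ?_
    field_simp
  simp_rw [Real.cosh_eq, ← neg_mul]
  have hK := abs_blockDev_le (P := P) hb ha
  rw [integral_div, integral_add (integrable_exp_of_abs_le (measurable_blockDev hg) hK t)
      (integrable_exp_of_abs_le (measurable_blockDev hg) hK (-t))]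
  have h1 := hexp t
  have h2 := hexp (-t)
  rw [neg_sq] at h2
  linarith

end Block

/-! ### Uniform control of the number of bad blocks -/

lemma sup'_le_sup'_add {T : Type*} {S : Finset T} (hS : S.Nonempty) {f g : T → ℝ} {c : ℝ}
    (h : ∀ t ∈ S, f t ≤ g t + c) : S.sup' hS f ≤ S.sup' hS g + c :=
  Finset.sup'_le hS f fun t ht => (h t ht).trans (by
    have := Finset.le_sup' g ht
    linarith)

lemma abs_sup'_le {T : Type*} {S : Finset T} (hS : S.Nonempty) {f : T → ℝ} {K : ℝ}
    (h : ∀ t, |f t| ≤ K) : |S.sup' hS f| ≤ K := by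
  obtain ⟨t, _, ht⟩ := S.exists_mem_eq_sup' hS f
  rw [ht]; exact h t

lemma measurable_sup'_apply {α T : Type*} [MeasurableSpace α] {S : Finset T} (hS : S.Nonempty)
    {f : T → α → ℝ} (hf : ∀ t, Measurable (f t)) :
    Measurable fun x => S.sup' hS (fun t => f t x) := by
  have := Finset.measurable_sup' hS (fun t _ => hf t)
  convert this using 2 with x
  simp [Finset.sup'_apply]

/-- The ramp `y ↦ 2y/ε` clipped to `[0, 1]`. -/
noncomputable def ramp (ε y : ℝ) : ℝ := min 1 (max 0 (2 / ε * y))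

lemma ramp_nonneg (ε y : ℝ) : 0 ≤ ramp ε y := le_min zero_le_one (le_max_left _ _)

lemma ramp_le_one (ε y : ℝ) : ramp ε y ≤ 1 := min_le_left _ _

/-- Saturation already at ε/2 leaves the other ε/2 for the error of passing to a net. -/
lemma one_le_ramp {ε y : ℝ} (hε : 0 < ε) (hy : ε / 2 ≤ y) : 1 ≤ ramp ε y := by
  refine le_min le_rfl (le_max_of_le_right ?_)
  rw [div_mul_eq_mul_div, le_div_iff₀ hε]; linarith

lemma ramp_le_abs {ε : ℝ} (hε : 0 < ε) (y : ℝ) : ramp ε y ≤ 2 / ε * |y| := by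
  refine (min_le_right _ _).trans (max_le (by positivity) ?_)
  exact mul_le_mul_of_nonneg_left (le_abs_self y) (by positivity)

/-- Clipping is a contraction. This is what the ramp has over an indicator: increments of counts
inherit the smallness of increments of block averages. -/
lemma abs_ramp_sub_le (ε x y : ℝ) : |ramp ε x - ramp ε y| ≤ |2 / ε * (x - y)| := by
  unfold ramp
  rw [mul_sub]
  refine (abs_min_sub_min_le_max _ _ _ _).trans (max_le (by simp) ?_)
  refine (abs_max_sub_max_le_max _ _ _ _).trans (max_le (by simp) le_rfl)

@[fun_prop]
lemma measurable_ramp (ε : ℝ) : Measurable (ramp ε) := by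
  unfold ramp; fun_prop

section Uniform

variable {E : Type*} [MeasurableSpace E] {T : Type*}

/-- The smoothed number of blocks whose average exceeds the mean of `g`. -/
noncomputable def badCount (P : Measure E) {b n : ℕ} (ε : ℝ) (g : E → ℝ)
    (x : Fin n → Fin b → E) : ℝ :=
  ∑ l, ramp ε (blockDev P g (x l))

/-- The mean of the smoothed indicator of a bad block. -/
noncomputable def badMean (P : Measure E) (b : ℕ) (ε : ℝ) (g : E → ℝ) : ℝ :=
  ∫ z : Fin b → E, ramp ε (blockDev P g z) ∂(Measure.pi fun _ => P)

variable {P : Measure E} {b n : ℕ} {ε : ℝ}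

lemma measurable_badCount {g : E → ℝ} (hg : Measurable g) :
    Measurable (badCount P (b := b) (n := n) ε g) := by
  unfold badCount
  refine Finset.measurable_sum _ fun l _ => ?_
  exact (measurable_ramp ε).comp ((measurable_blockDev hg).comp (measurable_pi_apply l))

lemma abs_badCount_le (g : E → ℝ) (x : Fin n → Fin b → E) : |badCount P ε g x| ≤ n := by
  unfold badCount
  rw [abs_of_nonneg (Finset.sum_nonneg fun l _ => ramp_nonneg _ _)]
  refine (Finset.sum_le_sum fun l _ => ramp_le_one _ _).trans (by simp)

lemma badCount_update_le (g : E → ℝ) (x : Fin n → Fin b → E) (i : Fin n) (y : Fin b → E) :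
    |badCount P ε g (Function.update x i y) - badCount P ε g x| ≤ 1 := by
  unfold badCount
  rw [← Finset.sum_sub_distrib, Finset.sum_eq_single i]
  · rw [Function.update_self, abs_le]
    constructor <;> linarith [ramp_nonneg ε (blockDev P g y), ramp_le_one ε (blockDev P g y),
      ramp_nonneg ε (blockDev P g (x i)), ramp_le_one ε (blockDev P g (x i))]
  · intro l _ hl
    rw [Function.update_of_ne hl, sub_self]
  · simp

lemma card_le_badCount (hε : 0 < ε) (g : E → ℝ) (x : Fin n → Fin b → E) (A : Finset (Fin n))
    (hA : ∀ l ∈ A, ε / 2 ≤ blockDev P g (x l)) : (A.card : ℝ) ≤ badCount P ε g x := by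
  unfold badCount
  calc (A.card : ℝ) = ∑ l ∈ A, (1 : ℝ) := by simp
    _ ≤ ∑ l ∈ A, ramp ε (blockDev P g (x l)) :=
        Finset.sum_le_sum fun l hl => one_le_ramp hε (hA l hl)
    _ ≤ _ := Finset.sum_le_sum_of_subset_of_nonneg (Finset.subset_univ _)
        fun _ _ _ => ramp_nonneg _ _

variable [IsProbabilityMeasure P]

lemma abs_badMean_le (g : E → ℝ) : |badMean P b ε g| ≤ 1 :=
  abs_integral_le_of_abs_le fun z => by
    rw [abs_of_nonneg (ramp_nonneg _ _)]; exact ramp_le_one _ _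

/-- A Markov-type bound: the ramp lies below 2|y|/ε, and a block deviation has first absolute moment
at most 2a/√b. -/
lemma badMean_le (hb : 0 < b) (hε : 0 < ε) {g : E → ℝ} (hg : Measurable g) {a : ℝ} (ha0 : 0 < a)
    (ha : ∀ x, |g x| ≤ a) : badMean P b ε g ≤ 4 * a / (ε * √b) := by
  have hb' : (0 : ℝ) < b := by exact_mod_cast hb
  have h1 : ∫ z : Fin b → E, |blockDev P g z| ∂(Measure.pi fun _ => P) ≤ 2 * √(a ^ 2 / b) :=
    integral_abs_le_of_cosh (measurable_blockDev hg) (by positivity) (abs_blockDev_le hb ha)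
      (integral_cosh_blockDev_le hb hg ha)
  have h2 : badMean P b ε g ≤ ∫ z : Fin b → E, 2 / ε * |blockDev P g z| ∂(Measure.pi fun _ => P) := by
    refine integral_mono ?_ ?_ fun z => ramp_le_abs hε _
    · exact integrable_of_abs_le ((measurable_ramp ε).comp (measurable_blockDev hg)) (K := 1)
        fun z => by rw [abs_of_nonneg (ramp_nonneg _ _)]; exact ramp_le_one _ _
    · exact (integrable_of_abs_le (measurable_blockDev hg) (abs_blockDev_le hb ha)).abs.const_mul _
  rw [integral_const_mul] at h2
  refine h2.trans ((mul_le_mul_of_nonneg_left h1 (by positivity)).trans (le_of_eq ?_))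
  rw [Real.sqrt_div (sq_nonneg a), Real.sqrt_sq ha0.le]
  field_simp
  ring

/-- The increments of the centered smoothed counts are sub-Gaussian. -/
lemma integral_exp_badCount_sub_le (hb : 0 < b) (hε : 0 < ε) {g h : E → ℝ}
    (hg : Measurable g) (hh : Measurable h) {K : ℝ} (hgK : ∀ x, |g x| ≤ K) (hhK : ∀ x, |h x| ≤ K)
    {r : ℝ} (hr : ∀ x, |g x - h x| ≤ r) (t : ℝ) :
    ∫ x : Fin n → Fin b → E, Real.exp (t * ((badCount P ε g x - n * badMean P b ε g)
        - (badCount P ε h x - n * badMean P b ε h))) ∂(Measure.pi fun _ => Measure.pi fun _ => P)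
      ≤ Real.exp (t ^ 2 * (8 * n * r ^ 2 / (ε ^ 2 * b)) / 2) := by
  set ν : Measure (Fin b → E) := Measure.pi fun _ => P
  set w : (Fin b → E) → ℝ := fun z => ramp ε (blockDev P g z) - ramp ε (blockDev P h z) with hw
  have hgm : Measurable fun z : Fin b → E => ramp ε (blockDev P g z) :=
    (measurable_ramp ε).comp (measurable_blockDev hg)
  have hhm : Measurable fun z : Fin b → E => ramp ε (blockDev P h z) :=
    (measurable_ramp ε).comp (measurable_blockDev hh)
  have hbd : ∀ y, |ramp ε y| ≤ 1 := fun y => by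
    rw [abs_of_nonneg (ramp_nonneg _ _)]; exact ramp_le_one _ _
  have hwm : ∫ z, w z ∂ν = badMean P b ε g - badMean P b ε h :=
    integral_sub (integrable_of_abs_le hgm fun z => hbd _) (integrable_of_abs_le hhm fun z => hbd _)
  -- The dominating sub-Gaussian function: the ramp is 2/ε-Lipschitz and block deviations are linear
  -- in the function.
  set V : (Fin b → E) → ℝ := fun z => 2 / ε * blockDev P (fun x => g x - h x) z with hV
  have hwV : ∀ z, |w z| ≤ |V z| := fun z => by
    simp only [hw, hV]
    rw [← blockDev_sub (integrable_of_abs_le hg hgK) (integrable_of_abs_le hh hhK)]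
    exact abs_ramp_sub_le _ _ _
  have hVm : Measurable V := (measurable_blockDev (hg.sub hh)).const_mul _
  have hVK : ∀ z, |V z| ≤ 2 / ε * (2 * r) := fun z => by
    simp only [hV]
    rw [abs_mul, abs_of_pos (by positivity : 0 < 2 / ε)]
    exact mul_le_mul_of_nonneg_left (abs_blockDev_le hb hr z) (by positivity)
  have hcosh : ∀ t : ℝ, ∫ z, Real.cosh (t * V z) ∂ν
      ≤ Real.exp (t ^ 2 * ((2 / ε) ^ 2 * (r ^ 2 / b)) / 2) := fun t => by
    have := integral_cosh_blockDev_le (P := P) hb (hg.sub hh) (a := r) hr (t * (2 / ε))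
    simp only [hV, ← mul_assoc]
    refine this.trans (Real.exp_le_exp.2 (le_of_eq ?_))
    ring
  have hwmeas : Measurable w := hgm.sub hhm
  have h1 := integral_exp_centered_le hwmeas hVm hwV hVK hcosh t
  rw [hwm] at h1
  have h2 : ∀ x : Fin n → Fin b → E, (badCount P ε g x - n * badMean P b ε g)
        - (badCount P ε h x - n * badMean P b ε h)
      = ∑ l, (w (x l) - (badMean P b ε g - badMean P b ε h)) := fun x => by
    simp only [hw, badCount, Finset.sum_sub_distrib, Finset.sum_const, Finset.card_univ,
      Fintype.card_fin, nsmul_eq_mul]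
    ring
  simp_rw [h2]
  rw [integral_exp_sum_pi n (fun z => w z - (badMean P b ε g - badMean P b ε h))]
  refine (pow_le_pow_left₀ (integral_nonneg fun _ => (Real.exp_pos _).le) h1 n).trans ?_
  rw [← Real.exp_nat_mul, Real.exp_le_exp]
  refine le_of_eq ?_
  field_simp
  ring

/-- **Chaining** for the centered smoothed counts along a sequence of nets. -/
lemma integral_sup'_badCount_centered_le (hb : 0 < b) (hn : 0 < n) (hε : 0 < ε) {F : T → E → ℝ}
    (hF : ∀ t, Measurable (F t)) {K : ℝ} (hK : ∀ t x, |F t x| ≤ K) {S : ℕ → Finset T}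
    (hS : ∀ m, (S m).Nonempty) (hS0 : (S 0).card = 1) {d a : ℝ} (hd : 0 < d) (ha : 0 < a)
    (hcard : ∀ m : ℕ, Real.log (S m).card ≤ m * d)
    (hpar : ∀ m, ∀ t ∈ S (m + 1), ∃ t' ∈ S m, ∀ x, |F t x - F t' x| ≤ a / 2 ^ m) (m : ℕ) :
    ∫ x : Fin n → Fin b → E, (S m).sup' (hS m)
        (fun t => badCount P ε (F t) x - n * badMean P b ε (F t))
          ∂(Measure.pi fun _ => Measure.pi fun _ => P)
      ≤ √(d * (8 * n * a ^ 2 / (ε ^ 2 * b))) * (6 - (2 * m + 6) / 2 ^ m) := by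
  have hb' : (0 : ℝ) < b := by exact_mod_cast hb
  have hn' : (0 : ℝ) < n := by exact_mod_cast hn
  set v := 8 * n * a ^ 2 / (ε ^ 2 * b) with hv
  have hv0 : 0 < v := by positivity
  -- The chaining scale. At level m the entropy is at most (m+1)d and the proxy v/4^m; the parameter
  -- 2^m d/κ then costs κ(m+1)/2^m + κ/(2·2^m).
  set κ := √(d * v) with hκ
  have hκ0 : 0 < κ := Real.sqrt_pos.2 (by positivity)
  have hκ2 : κ ^ 2 = d * v := Real.sq_sqrt (by positivity)
  set μ : Measure (Fin n → Fin b → E) := Measure.pi fun _ => Measure.pi fun _ => P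
  set G : T → (Fin n → Fin b → E) → ℝ :=
    fun t x => badCount P ε (F t) x - n * badMean P b ε (F t) with hG
  have hGm : ∀ t, Measurable (G t) := fun t => (measurable_badCount (hF t)).sub_const _
  have hGK : ∀ t x, |G t x| ≤ n + n := fun t x => by
    refine (abs_sub _ _).trans (add_le_add (abs_badCount_le _ _) ?_)
    rw [abs_mul, abs_of_pos hn']
    exact mul_le_of_le_one_right hn'.le (abs_badMean_le _)
  have hint : ∀ m, Integrable (fun x => (S m).sup' (hS m) (fun t => G t x)) μ := fun m =>
    integrable_of_abs_le (measurable_sup'_apply (hS m) hGm) fun x => abs_sup'_le (hS m) (hGK · x)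
  induction m with
  | zero =>
    -- The claimed bound is 0 at level 0, which holds because a single centered count has mean zero.
    obtain ⟨t₀, ht₀⟩ := Finset.card_eq_one.1 hS0
    have h0 : ∀ x, (S 0).sup' (hS 0) (fun t => G t x) = G t₀ x := fun x => by
      obtain ⟨t, ht, htx⟩ := (S 0).exists_mem_eq_sup' (hS 0) (fun t => G t x)
      rw [ht₀, Finset.mem_singleton] at ht
      rw [htx, ht]
    have hcount : ∫ x, badCount P ε (F t₀) x ∂μ = n * badMean P b ε (F t₀) := by
      have hrm : Measurable fun z : Fin b → E => ramp ε (blockDev P (F t₀) z) :=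
        (measurable_ramp ε).comp (measurable_blockDev (hF t₀))
      unfold badCount
      rw [integral_finsetSum]
      · have : ∀ l : Fin n, ∫ x : Fin n → Fin b → E, ramp ε (blockDev P (F t₀) (x l)) ∂μ
            = badMean P b ε (F t₀) := fun l =>
          integral_comp_eval (μ := fun _ : Fin n => Measure.pi fun _ : Fin b => P) (i := l)
            hrm.aestronglyMeasurable
        simp [this]
      · intro l _
        exact integrable_of_abs_le (hrm.comp (measurable_pi_apply l)) (K := 1) fun z => by
          rw [abs_of_nonneg (ramp_nonneg _ _)]; exact ramp_le_one _ _
    have h1 : ∫ x, (S 0).sup' (hS 0) (fun t => G t x) ∂μ = ∫ x, G t₀ x ∂μ :=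
      integral_congr_ae (ae_of_all _ h0)
    refine le_of_eq (h1.trans ?_)
    rw [integral_sub (integrable_of_abs_le (measurable_badCount (hF t₀)) fun x =>
      abs_badCount_le _ x) (integrable_const _), hcount]
    simp
  | succ m ih =>
    choose! q hqS hq using hpar m
    have hqm : ∀ t, Measurable fun x => G t x - G (q t) x := fun t => (hGm t).sub (hGm (q t))
    have hD : ∫ x, (S (m + 1)).sup' (hS (m + 1)) (fun t => G t x - G (q t) x) ∂μ
        ≤ (m + 1) * d / (2 ^ m * d / κ) + (2 ^ m * d / κ) * (v / 4 ^ m) / 2 := by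
      refine integral_sup'_le (hS (m + 1)) hqm
        (K := (n + n) + (n + n)) (fun t x => (abs_sub _ _).trans (add_le_add (hGK _ _) (hGK _ _)))
        (by positivity) (by exact_mod_cast hcard (m + 1)) fun t ht => ?_
      refine (integral_exp_badCount_sub_le hb hε (hF t) (hF (q t)) (hK t) (hK (q t)) (hq t ht)
        _).trans (Real.exp_le_exp.2 (le_of_eq ?_))
      have h4 : (4 : ℝ) ^ m = 2 ^ m * 2 ^ m := by rw [← mul_pow]; norm_num
      rw [hv, div_pow a, h4]
      field_simp
    have hsum : ∫ x, (S (m + 1)).sup' (hS (m + 1)) (fun t => G t x) ∂μ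
        ≤ ∫ x, ((S m).sup' (hS m) (fun t => G t x)
          + (S (m + 1)).sup' (hS (m + 1)) (fun t => G t x - G (q t) x)) ∂μ := by
      refine integral_mono (hint _) ((hint m).add (integrable_of_abs_le
        (measurable_sup'_apply (hS (m + 1)) hqm)
        (K := (n + n) + (n + n)) fun x => abs_sup'_le _ fun t =>
          (abs_sub _ _).trans (add_le_add (hGK _ _) (hGK _ _)))) fun x => ?_
      refine Finset.sup'_le _ _ fun t ht => ?_
      have h1 := Finset.le_sup' (fun t => G t x) (hqS t ht)
      have h2 := Finset.le_sup' (fun t => G t x - G (q t) x) ht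
      simp only at h1 h2 ⊢
      linarith
    rw [integral_add (hint m) (integrable_of_abs_le
        (measurable_sup'_apply (hS (m + 1)) hqm)
        (K := (n + n) + (n + n)) fun x => abs_sup'_le _ fun t =>
          (abs_sub _ _).trans (add_le_add (hGK _ _) (hGK _ _)))] at hsum
    refine hsum.trans ((add_le_add ih hD).trans ?_)
    have h4 : (4 : ℝ) ^ m = 2 ^ m * 2 ^ m := by rw [← mul_pow]; norm_num
    have h5 : (m + 1) * d / (2 ^ m * d / κ) = κ * ((m + 1) / 2 ^ m) := by field_simp
    have h6 : (2 ^ m * d / κ) * (v / 4 ^ m) / 2 = κ * (1 / 2 / 2 ^ m) := by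
      rw [h4]; field_simp; rw [hκ2]
    rw [h5, h6, ← mul_add, ← mul_add]
    refine mul_le_mul_of_nonneg_left ?_ hκ0.le
    have hp : (0 : ℝ) < 2 ^ m := by positivity
    rw [pow_succ]
    push_cast
    rw [← sub_nonneg]
    -- The closed form grows by (m+2)/2^m per level, while a level costs (m+3/2)/2^m.
    have : 6 - (2 * ((m : ℝ) + 1) + 6) / (2 ^ m * 2)
        - (6 - (2 * m + 6) / 2 ^ m + ((m + 1) / 2 ^ m + 1 / 2 / 2 ^ m)) = 1 / 2 / 2 ^ m := by
      field_simp; ring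
    rw [this]; positivity

/-- With high probability, few blocks are bad, uniformly over a net. -/
lemma measureReal_exists_badCount_le (hb : 0 < b) (hn : 0 < n) (hε : 0 < ε) {F : T → E → ℝ}
    (hF : ∀ t, Measurable (F t)) {K : ℝ} (hK0 : 0 < K) (hK : ∀ t x, |F t x| ≤ K) {S : ℕ → Finset T}
    (hS : ∀ m, (S m).Nonempty) (hS0 : (S 0).card = 1) {d a : ℝ} (hd : 0 < d) (ha : 0 < a)
    (hcard : ∀ m : ℕ, Real.log (S m).card ≤ m * d)
    (hpar : ∀ m, ∀ t ∈ S (m + 1), ∃ t' ∈ S m, ∀ x, |F t x - F t' x| ≤ a / 2 ^ m) (m : ℕ)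
    {N δ c : ℝ} (hnN : n ≤ N) (hδ : 0 ≤ δ)
    (hc : N * (4 * K / (ε * √b)) + 6 * √(d * (8 * N * a ^ 2 / (ε ^ 2 * b))) ≤ c) :
    (Measure.pi fun _ => Measure.pi fun _ => P).real
        {x : Fin n → Fin b → E | c + N * δ ≤ (S m).sup' (hS m) fun t => badCount P ε (F t) x}
      ≤ Real.exp (-2 * N * δ ^ 2) := by
  have hb' : (0 : ℝ) < b := by exact_mod_cast hb
  have hn' : (0 : ℝ) < n := by exact_mod_cast hn
  have hcm : ∀ t, Measurable (badCount P (n := n) (b := b) ε (F t)) :=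
    fun t => measurable_badCount (hF t)
  refine measureReal_ge_le_of_bounded_differences (measurable_sup'_apply (hS m) hcm) (K := n)
    (fun x => abs_sup'_le _ fun t => abs_badCount_le _ _) (fun x i y => ?_) hnN hδ ?_
  · rw [abs_sub_le_iff]
    constructor
    · have := sup'_le_sup'_add (hS m) (c := 1)
        (f := fun t => badCount P ε (F t) (Function.update x i y))
        (g := fun t => badCount P ε (F t) x) fun t _ => by
          linarith [(abs_le.1 (badCount_update_le (P := P) (ε := ε) (F t) x i y)).2]
      linarith
    · have := sup'_le_sup'_add (hS m) (c := 1)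
        (g := fun t => badCount P ε (F t) (Function.update x i y))
        (f := fun t => badCount P ε (F t) x) fun t _ => by
          linarith [(abs_le.1 (badCount_update_le (P := P) (ε := ε) (F t) x i y)).1]
      linarith
  · have h1 := integral_sup'_badCount_centered_le (P := P) hb hn hε hF hK hS hS0 hd ha hcard hpar m
    set μ : Measure (Fin n → Fin b → E) := Measure.pi fun _ => Measure.pi fun _ => P
    have hGm : ∀ t, Measurable fun x : Fin n → Fin b → E =>
        badCount P ε (F t) x - n * badMean P b ε (F t) := fun t => (hcm t).sub_const _
    have hGK : ∀ t (x : Fin n → Fin b → E),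
        |badCount P ε (F t) x - n * badMean P b ε (F t)| ≤ n + n := fun t x => by
      refine (abs_sub _ _).trans (add_le_add (abs_badCount_le _ _) ?_)
      rw [abs_mul, abs_of_pos hn']
      exact mul_le_of_le_one_right hn'.le (abs_badMean_le _)
    have hI : Integrable (fun x => (S m).sup' (hS m) (fun t => badCount P ε (F t) x
        - n * badMean P b ε (F t))) μ :=
      integrable_of_abs_le (measurable_sup'_apply (hS m) hGm) fun x => abs_sup'_le (hS m) (hGK · x)
    -- Uncentering: every mean count is at most n times the bound of `badMean_le`, uniformly over
    -- the net.
    have h2 : ∫ x, (S m).sup' (hS m) (fun t => badCount P ε (F t) x) ∂μ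
        ≤ ∫ x, ((S m).sup' (hS m) (fun t => badCount P ε (F t) x - n * badMean P b ε (F t))
          + n * (4 * K / (ε * √b))) ∂μ := by
      refine integral_mono (integrable_of_abs_le (measurable_sup'_apply (hS m) hcm)
        fun x => abs_sup'_le (hS m) fun t => abs_badCount_le _ x) (hI.add (integrable_const _))
        fun x => sup'_le_sup'_add _ fun t _ => ?_
      have := mul_le_mul_of_nonneg_left (badMean_le (P := P) hb hε (hF t) hK0 (hK t)) hn'.le
      linarith
    rw [integral_add hI (integrable_const _)] at h2
    have h3 : ∫ _x, (n * (4 * K / (ε * √b)) : ℝ) ∂μ = n * (4 * K / (ε * √b)) := by simp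
    rw [h3] at h2
    refine h2.trans (le_trans ?_ hc)
    rw [add_comm]
    refine add_le_add (mul_le_mul_of_nonneg_right hnN (by positivity)) (h1.trans ?_)
    rw [mul_comm]
    refine mul_le_mul ?_ (Real.sqrt_le_sqrt ?_) (Real.sqrt_nonneg _) (by norm_num)
    · have : (0 : ℝ) ≤ (2 * m + 6) / 2 ^ m := by positivity
      linarith
    · gcongr

end Uniform

/-! ### The cube -/

section Cube

variable {k p : ℕ} {M : ℝ}

lemma norm_le_sqrt_mul {v : EuclideanSpace ℝ (Fin p)} {r : ℝ} (hr : 0 ≤ r) (h : ∀ i, |v i| ≤ r) :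
    ‖v‖ ≤ √p * r := by
  refine abs_le_of_sq_le_sq' ?_ (by positivity) |>.2
  rw [EuclideanSpace.real_norm_sq_eq, mul_pow, Real.sq_sqrt (Nat.cast_nonneg p)]
  calc ∑ i, v i ^ 2 ≤ ∑ _i : Fin p, r ^ 2 :=
        Finset.sum_le_sum fun i _ => sq_le_sq' (abs_le.1 (h i)).1 (abs_le.1 (h i)).2
    _ = p * r ^ 2 := by simp

lemma mem_cube_iff {x : EuclideanSpace ℝ (Fin p)} : x ∈ cube p M ↔ ∀ i, |x i| ≤ M := by
  simp only [cube, Set.mem_ofPred_eq, Set.mem_Icc, abs_le]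

lemma norm_sub_le_of_mem_cube (hM : 0 ≤ M) {x y : EuclideanSpace ℝ (Fin p)} (hx : x ∈ cube p M)
    (hy : y ∈ cube p M) : ‖x - y‖ ≤ √p * (2 * M) :=
  norm_le_sqrt_mul (by positivity) fun i => by
    have h1 := mem_cube_iff.1 hx i
    have h2 := mem_cube_iff.1 hy i
    simpa [two_mul] using (abs_sub (x i) (y i)).trans (add_le_add h1 h2)

lemma cube_eq_preimage : cube p M =
    (EuclideanSpace.equiv (Fin p) ℝ) ⁻¹' (Set.univ.pi fun _ => Set.Icc (-M) M) := by
  ext x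
  simp only [cube, Set.mem_preimage, Set.mem_univ_pi]
  rfl

lemma isCompact_cube : IsCompact (cube p M) := by
  rw [cube_eq_preimage]
  exact (EuclideanSpace.equiv (Fin p) ℝ).toHomeomorph.isCompact_preimage.2
    (isCompact_univ_pi fun _ => isCompact_Icc)

lemma convex_cube : Convex ℝ (cube p M) := by
  rw [cube_eq_preimage]
  exact (convex_pi fun _ _ => convex_Icc _ _).linear_preimage
    (EuclideanSpace.equiv (Fin p) ℝ).toLinearEquiv.toLinearMap

lemma zero_mem_cube (hM : 0 ≤ M) : (0 : EuclideanSpace ℝ (Fin p)) ∈ cube p M :=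
  mem_cube_iff.2 fun i => by simpa using hM

/-- Repeated bisection: each midpoint is replaced by the midpoints of its two halves. The bound M -
M/2^m keeps the net inside the interval, so that the Lipschitz hypothesis on the cube applies to net
points. -/
lemma exists_interval_net (hM : 0 ≤ M) (m : ℕ) : ∃ C : Finset ℝ, C.card ≤ 2 ^ m ∧
    (∀ c ∈ C, |c| ≤ M - M / 2 ^ m) ∧ ∀ y, |y| ≤ M → ∃ c ∈ C, |y - c| ≤ M / 2 ^ m := by
  induction m with
  | zero => exact ⟨{0}, by simp, by simp, fun y hy => ⟨0, by simp, by simpa using hy⟩⟩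
  | succ m ih =>
    classical
    obtain ⟨C, hC, hCM, hCn⟩ := ih
    set h := M / 2 ^ (m + 1) with hh
    have h2 : M / 2 ^ m = h + h := by rw [hh, pow_succ]; field_simp; norm_num
    have h0 : 0 ≤ h := by positivity
    refine ⟨C.image (fun c => c - h) ∪ C.image (fun c => c + h), ?_, ?_, ?_⟩
    · refine (Finset.card_union_le _ _).trans ?_
      rw [pow_succ]
      linarith [(Finset.card_image_le (s := C) (f := fun c => c - h)),
        (Finset.card_image_le (s := C) (f := fun c => c + h))]
    · intro c hc
      rw [Finset.mem_union, Finset.mem_image, Finset.mem_image] at hc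
      rcases hc with ⟨a, ha, rfl⟩ | ⟨a, ha, rfl⟩ <;>
      · have := abs_le.1 (hCM a ha)
        rw [abs_le]; constructor <;> linarith
    · intro y hy
      obtain ⟨c, hc, hyc⟩ := hCn y hy
      rw [h2, abs_le] at hyc
      rcases le_total y c with h1 | h1
      · exact ⟨c - h, Finset.mem_union_left _ (Finset.mem_image_of_mem _ hc),
          abs_le.2 ⟨by linarith, by linarith⟩⟩
      · exact ⟨c + h, Finset.mem_union_right _ (Finset.mem_image_of_mem _ hc),
          abs_le.2 ⟨by linarith, by linarith⟩⟩

/-- Dyadic nets of the cube of centroids. -/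
lemma exists_centroid_net (k p : ℕ) (hM : 0 ≤ M) (m : ℕ) :
    ∃ S : Finset (Fin k → EuclideanSpace ℝ (Fin p)), S.card ≤ 2 ^ (m * (k * p)) ∧
      (∀ Θ ∈ S, Θ ∈ centroidCube k p M) ∧ ∀ Θ ∈ centroidCube k p M, ∃ Θ' ∈ S,
        ∀ j i, |Θ j i - Θ' j i| ≤ M / 2 ^ m := by
  classical
  obtain ⟨C, hC, hCM, hCn⟩ := exists_interval_net hM m
  refine ⟨(Fintype.piFinset fun _ : Fin k => Fintype.piFinset fun _ : Fin p => C).image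
    fun Θ j => WithLp.toLp 2 (Θ j), ?_, ?_, ?_⟩
  · refine Finset.card_image_le.trans ?_
    simp only [Fintype.card_piFinset_const]
    calc (C.card ^ p) ^ k ≤ ((2 ^ m) ^ p) ^ k :=
          Nat.pow_le_pow_left (Nat.pow_le_pow_left hC p) k
      _ = 2 ^ (m * (k * p)) := by rw [← pow_mul, ← pow_mul]; congr 1; ring
  · intro Θ hΘ
    rw [Finset.mem_image] at hΘ
    obtain ⟨Φ, hΦ, rfl⟩ := hΘ
    intro j
    rw [mem_cube_iff]
    intro i
    have := hCM _ (Fintype.mem_piFinset.1 (Fintype.mem_piFinset.1 hΦ j) i)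
    have h0 : 0 ≤ M / 2 ^ m := by positivity
    simp only
    linarith
  · intro Θ hΘ
    have : ∀ j i, ∃ c ∈ C, |Θ j i - c| ≤ M / 2 ^ m := fun j i =>
      hCn _ (mem_cube_iff.1 (hΘ j) i)
    choose c hc hcΘ using this
    refine ⟨fun j => WithLp.toLp 2 (c j), Finset.mem_image.2 ⟨c, ?_, rfl⟩, hcΘ⟩
    exact Fintype.mem_piFinset.2 fun j => Fintype.mem_piFinset.2 fun i => hc j i

end Cube

/-! ### Bregman divergences -/

section Bregman

variable {p : ℕ} {M H : ℝ} {φ : EuclideanSpace ℝ (Fin p) → ℝ}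

/-- On the line from y to x, a convex function of one variable has its derivative at 0 at most its
slope over [0, 1]. -/
lemma bregmanDiv_nonneg (hc : ConvexOn ℝ Set.univ φ) (hd : Differentiable ℝ φ)
    (x y : EuclideanSpace ℝ (Fin p)) : 0 ≤ bregmanDiv φ x y := by
  have hg : ConvexOn ℝ Set.univ fun s : ℝ => φ (AffineMap.lineMap y x s) := by
    have := hc.comp_affineMap (AffineMap.lineMap (k := ℝ) y x)
    rwa [Set.preimage_univ] at this
  have hder : HasDerivAt (fun s : ℝ => φ (AffineMap.lineMap y x s))
      (inner ℝ (gradient φ y) (x - y)) 0 := by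
    rw [inner_gradient_left]
    have h1 : HasDerivAt (fun s : ℝ => AffineMap.lineMap (k := ℝ) y x s) (x - y) 0 :=
      AffineMap.hasDerivAt_lineMap
    have h2 : HasFDerivAt φ (fderiv ℝ φ y) (AffineMap.lineMap (k := ℝ) y x (0 : ℝ)) := by
      simpa using (hd y).hasFDerivAt
    exact h2.comp_hasDerivAt 0 h1
  have := hg.le_slope_of_hasDerivAt (Set.mem_univ 0) (Set.mem_univ 1) one_pos hder
  simp only [slope_def_field, AffineMap.lineMap_apply_one, AffineMap.lineMap_apply_zero] at this
  unfold bregmanDiv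
  linarith

/-- The three-point identity, behind the upper bound, the Lipschitz bound in the centroid and the
projection inequality alike. -/
lemma bregmanDiv_sub (x y z : EuclideanSpace ℝ (Fin p)) :
    bregmanDiv φ x y - bregmanDiv φ x z
      = bregmanDiv φ z y + inner ℝ (gradient φ z - gradient φ y) (x - z) := by
  unfold bregmanDiv
  have : x - y = (x - z) + (z - y) := by abel
  rw [this, inner_add_right, inner_sub_left]
  ring

lemma bregmanDiv_self (x : EuclideanSpace ℝ (Fin p)) : bregmanDiv φ x x = 0 := by
  simp [bregmanDiv]

/-- The symmetrized divergence d(x,y) + d(y,x) equals ⟨∇φ(x) - ∇φ(y), x - y⟩; dropping d(y,x) ≥ 0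
avoids integrating the gradient, at the price of H instead of H/2. -/
lemma bregmanDiv_le (hc : ConvexOn ℝ Set.univ φ) (hd : Differentiable ℝ φ)
    (hL : ∀ x ∈ cube p M, ∀ y ∈ cube p M, ‖gradient φ x - gradient φ y‖ ≤ H * ‖x - y‖)
    {x y : EuclideanSpace ℝ (Fin p)} (hx : x ∈ cube p M) (hy : y ∈ cube p M) :
    bregmanDiv φ x y ≤ H * ‖x - y‖ ^ 2 := by
  have h1 := bregmanDiv_sub (φ := φ) y y x
  rw [bregmanDiv_self] at h1
  have h2 := bregmanDiv_nonneg hc hd y x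
  have h3 : -inner ℝ (gradient φ x - gradient φ y) (y - x) ≤ H * ‖x - y‖ * ‖x - y‖ := by
    rw [← inner_neg_right, neg_sub]
    exact (real_inner_le_norm _ _).trans
      (mul_le_mul_of_nonneg_right (hL x hx y hy) (norm_nonneg _))
  nlinarith

/-- Both terms of the three-point identity carry a factor ‖z - y‖ ≤ √p r; the remaining factor is at
most the diameter 2M√p. -/
lemma abs_bregmanDiv_sub_le (hc : ConvexOn ℝ Set.univ φ) (hd : Differentiable ℝ φ) (hM : 0 ≤ M)
    (hH : 0 ≤ H)
    (hL : ∀ x ∈ cube p M, ∀ y ∈ cube p M, ‖gradient φ x - gradient φ y‖ ≤ H * ‖x - y‖)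
    {x y z : EuclideanSpace ℝ (Fin p)} (hx : x ∈ cube p M) (hy : y ∈ cube p M)
    (hz : z ∈ cube p M) {r : ℝ} (hr : 0 ≤ r) (hyz : ∀ i, |y i - z i| ≤ r) :
    |bregmanDiv φ x y - bregmanDiv φ x z| ≤ 4 * H * M * p * r := by
  have hn : ‖z - y‖ ≤ √p * r := by
    rw [norm_sub_rev]; exact norm_le_sqrt_mul hr hyz
  have h1 := bregmanDiv_le hc hd hL hz hy
  have h2 := bregmanDiv_nonneg hc hd z y
  have h3 : |inner ℝ (gradient φ z - gradient φ y) (x - z)| ≤ H * ‖z - y‖ * ‖x - z‖ :=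
    (abs_real_inner_le_norm _ _).trans
      (mul_le_mul_of_nonneg_right (hL z hz y hy) (norm_nonneg _))
  have h4 := norm_sub_le_of_mem_cube hM hz hy
  have h5 := norm_sub_le_of_mem_cube hM hx hz
  rw [bregmanDiv_sub]
  calc |bregmanDiv φ z y + inner ℝ (gradient φ z - gradient φ y) (x - z)|
      ≤ H * ‖z - y‖ ^ 2 + H * ‖z - y‖ * ‖x - z‖ :=
        (abs_add_le _ _).trans (add_le_add (by rwa [abs_of_nonneg h2]) h3)
    _ = H * ‖z - y‖ * (‖z - y‖ + ‖x - z‖) := by ring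
    _ ≤ H * (√p * r) * (√p * (2 * M) + √p * (2 * M)) := by gcongr
    _ = 4 * H * M * (√p * √p) * r := by ring
    _ = _ := by rw [Real.mul_self_sqrt (Nat.cast_nonneg p)]

lemma continuous_bregmanDiv (hd : Differentiable ℝ φ) (y : EuclideanSpace ℝ (Fin p)) :
    Continuous fun x => bregmanDiv φ x y := by
  have := hd.continuous
  unfold bregmanDiv
  fun_prop

/-- The Bregman projection of a point onto the cube. -/
lemma exists_bregmanDiv_le (hc : ConvexOn ℝ Set.univ φ) (hd : Differentiable ℝ φ) (hM : 0 ≤ M)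
    (y : EuclideanSpace ℝ (Fin p)) :
    ∃ z ∈ cube p M, ∀ x ∈ cube p M, bregmanDiv φ x z ≤ bregmanDiv φ x y := by
  obtain ⟨z, hz, hmin⟩ := isCompact_cube.exists_isMinOn ⟨0, zero_mem_cube hM⟩
    (continuous_bregmanDiv hd y).continuousOn
  refine ⟨z, hz, fun x hx => ?_⟩
  have hder : HasFDerivAt (fun x => bregmanDiv φ x y)
      (fderiv ℝ φ z - innerSL ℝ (gradient φ y)) z := by
    unfold bregmanDiv
    refine ((hd z).hasFDerivAt.sub_const _).sub ?_
    have := ((innerSL ℝ (gradient φ y)).hasFDerivAt (x := z - y)).comp z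
      ((hasFDerivAt_id z).sub_const y)
    simpa [Function.comp_def] using this
  have hcone : x - z ∈ posTangentConeAt (cube p M) z :=
    sub_mem_posTangentConeAt_of_segment_subset (convex_cube.segment_subset hz hx)
  -- First-order optimality on the convex cube; through the three-point identity it becomes the
  -- generalized Pythagorean inequality.
  have h1 := hmin.localize.hasFDerivWithinAt_nonneg hder.hasFDerivWithinAt hcone
  have h2 : 0 ≤ inner ℝ (gradient φ z - gradient φ y) (x - z) := by
    rw [inner_sub_left, inner_gradient_left]
    simpa using h1
  have h3 := bregmanDiv_sub (φ := φ) x y z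
  linarith [bregmanDiv_nonneg hc hd z y]

end Bregman

/-! ### The clustering loss -/

section Loss

variable {k p : ℕ} {M τ H : ℝ} {Ψ : (Fin k → ℝ) → ℝ} {φ : EuclideanSpace ℝ (Fin p) → ℝ}

lemma bregmanDiv_mem_Ici (hc : ConvexOn ℝ Set.univ φ) (hd : Differentiable ℝ φ)
    (Θ : Fin k → EuclideanSpace ℝ (Fin p)) (x : EuclideanSpace ℝ (Fin p)) :
    (fun j => bregmanDiv φ x (Θ j)) ∈ Set.Ici (0 : Fin k → ℝ) :=
  fun _ => bregmanDiv_nonneg hc hd _ _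

lemma continuous_clusterLoss (hc : ConvexOn ℝ Set.univ φ) (hd : Differentiable ℝ φ)
    (hΨ : ∀ u ∈ Set.Ici (0 : Fin k → ℝ), ∀ v ∈ Set.Ici (0 : Fin k → ℝ),
      |Ψ u - Ψ v| ≤ τ * ∑ j, |u j - v j|) (Θ : Fin k → EuclideanSpace ℝ (Fin p)) :
    Continuous (clusterLoss Ψ φ Θ) := by
  rw [continuous_iff_continuousAt]
  intro x
  rw [ContinuousAt, tendsto_iff_dist_tendsto_zero]
  refine squeeze_zero (fun _ => dist_nonneg) (fun y => hΨ _ (bregmanDiv_mem_Ici hc hd Θ y) _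
    (bregmanDiv_mem_Ici hc hd Θ x)) ?_
  have hcont : Continuous fun y => τ * ∑ j, |bregmanDiv φ y (Θ j) - bregmanDiv φ x (Θ j)| := by
    have := fun j => continuous_bregmanDiv hd (Θ j)
    fun_prop
  simpa using hcont.tendsto x

lemma lipschitz_const_nonneg [NeZero k]
    (hΨ : ∀ u ∈ Set.Ici (0 : Fin k → ℝ), ∀ v ∈ Set.Ici (0 : Fin k → ℝ),
      |Ψ u - Ψ v| ≤ τ * ∑ j, |u j - v j|) : 0 ≤ τ := by
  have h := (abs_nonneg _).trans (hΨ 1 (fun _ => zero_le_one) 0 (fun _ => le_rfl))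
  have hk : (0 : ℝ) < k := by exact_mod_cast Nat.pos_of_ne_zero (NeZero.ne k)
  simp at h
  exact nonneg_of_mul_nonneg_left h hk

lemma abs_clusterLoss_le (hM : 0 ≤ M) (hc : ConvexOn ℝ Set.univ φ) (hd : Differentiable ℝ φ)
    (hH : 0 ≤ H)
    (hL : ∀ x ∈ cube p M, ∀ y ∈ cube p M, ‖gradient φ x - gradient φ y‖ ≤ H * ‖x - y‖)
    (hΨ0 : Ψ 0 = 0)
    (hΨ : ∀ u ∈ Set.Ici (0 : Fin k → ℝ), ∀ v ∈ Set.Ici (0 : Fin k → ℝ),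
      |Ψ u - Ψ v| ≤ τ * ∑ j, |u j - v j|)
    {Θ : Fin k → EuclideanSpace ℝ (Fin p)} (hΘ : Θ ∈ centroidCube k p M)
    {x : EuclideanSpace ℝ (Fin p)} (hx : x ∈ cube p M) :
    |clusterLoss Ψ φ Θ x| ≤ 4 * τ * H * M ^ 2 * (k * p) := by
  have h1 := hΨ _ (bregmanDiv_mem_Ici hc hd Θ x) 0 (Set.mem_Ici.2 le_rfl)
  rw [hΨ0, sub_zero] at h1
  refine h1.trans ?_
  rcases Nat.eq_zero_or_pos k with rfl | hk
  · simp
  have : NeZero k := ⟨hk.ne'⟩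
  have hτ := lipschitz_const_nonneg hΨ
  calc τ * ∑ j, |bregmanDiv φ x (Θ j) - (0 : Fin k → ℝ) j|
      ≤ τ * ∑ _j : Fin k, 4 * H * M ^ 2 * p := by
        gcongr with j
        rw [Pi.zero_apply, sub_zero, abs_of_nonneg (bregmanDiv_nonneg hc hd _ _)]
        have h2 := norm_sub_le_of_mem_cube hM hx (hΘ j)
        calc bregmanDiv φ x (Θ j) ≤ H * ‖x - Θ j‖ ^ 2 := bregmanDiv_le hc hd hL hx (hΘ j)
          _ ≤ H * (√p * (2 * M)) ^ 2 := by gcongr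
          _ = 4 * H * M ^ 2 * (√p ^ 2) := by ring
          _ = _ := by rw [Real.sq_sqrt (Nat.cast_nonneg p)]
    _ = _ := by simp; ring

/-- Applied with r = M/2^m, the bound is exactly the envelope of `abs_clusterLoss_le` divided by
2^m. -/
lemma abs_clusterLoss_sub_le (hM : 0 ≤ M) (hc : ConvexOn ℝ Set.univ φ) (hd : Differentiable ℝ φ)
    (hH : 0 ≤ H)
    (hL : ∀ x ∈ cube p M, ∀ y ∈ cube p M, ‖gradient φ x - gradient φ y‖ ≤ H * ‖x - y‖)
    (hτ : 0 ≤ τ)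
    (hΨ : ∀ u ∈ Set.Ici (0 : Fin k → ℝ), ∀ v ∈ Set.Ici (0 : Fin k → ℝ),
      |Ψ u - Ψ v| ≤ τ * ∑ j, |u j - v j|)
    {Θ Θ' : Fin k → EuclideanSpace ℝ (Fin p)} (hΘ : Θ ∈ centroidCube k p M)
    (hΘ' : Θ' ∈ centroidCube k p M) {x : EuclideanSpace ℝ (Fin p)} (hx : x ∈ cube p M)
    {r : ℝ} (hr : 0 ≤ r) (h : ∀ j i, |Θ j i - Θ' j i| ≤ r) :
    |clusterLoss Ψ φ Θ x - clusterLoss Ψ φ Θ' x| ≤ 4 * τ * H * M * (k * p) * r := by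
  refine (hΨ _ (bregmanDiv_mem_Ici hc hd Θ x) _ (bregmanDiv_mem_Ici hc hd Θ' x)).trans ?_
  calc τ * ∑ j, |bregmanDiv φ x (Θ j) - bregmanDiv φ x (Θ' j)|
      ≤ τ * ∑ _j : Fin k, 4 * H * M * p * r := by
        gcongr with j
        exact abs_bregmanDiv_sub_le hc hd hM hH hL hx (hΘ j) (hΘ' j) hr (h j)
    _ = _ := by simp; ring

end Loss

/-! ### Medians -/

section Median

variable {L : ℕ} {v : Fin L → ℝ} {c : ℝ}

lemma finMedian_mem_bounds (hL : 0 < L) :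
    v (Tuple.sort v ⟨(L - 1) / 2, by omega⟩) ≤ finMedian v ∧
      finMedian v ≤ v (Tuple.sort v ⟨L / 2, by omega⟩) := by
  have hmono : v (Tuple.sort v ⟨(L - 1) / 2, by omega⟩) ≤ v (Tuple.sort v ⟨L / 2, by omega⟩) :=
    Tuple.monotone_sort v (Fin.mk_le_mk.2 (by omega))
  unfold finMedian
  rw [dif_pos hL]
  constructor <;> linarith

/-- The upper middle value exceeds c, hence so do all L - ⌊L/2⌋ sorted values from its position on.
For even L this is exactly half. -/
lemma le_two_mul_card_lt_of_lt_finMedian (hL : 0 < L) (hc : c < finMedian v) :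
    L ≤ 2 * (Finset.univ.filter fun l => c < v l).card := by
  have h1 := hc.trans_le (finMedian_mem_bounds hL).2
  have h2 : (Finset.Ici (⟨L / 2, by omega⟩ : Fin L)).card
      ≤ (Finset.univ.filter fun l => c < v l).card := by
    refine Finset.card_le_card_of_injOn (Tuple.sort v) (fun i hi => ?_)
      (Tuple.sort v).injective.injOn
    have hi' : (⟨L / 2, by omega⟩ : Fin L) ≤ i := by simpa using hi
    simpa using h1.trans_le (Tuple.monotone_sort v hi')
  rw [Fin.card_Ici] at h2
  simp only at h2
  omega

lemma le_two_mul_card_lt_of_finMedian_lt (hL : 0 < L) (hc : finMedian v < c) :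
    L ≤ 2 * (Finset.univ.filter fun l => v l < c).card := by
  have h1 := (finMedian_mem_bounds hL).1.trans_lt hc
  have h2 : (Finset.Iic (⟨(L - 1) / 2, by omega⟩ : Fin L)).card
      ≤ (Finset.univ.filter fun l => v l < c).card := by
    refine Finset.card_le_card_of_injOn (Tuple.sort v) (fun i hi => ?_)
      (Tuple.sort v).injective.injOn
    have hi' : i ≤ (⟨(L - 1) / 2, by omega⟩ : Fin L) := by simpa using hi
    simpa using lt_of_le_of_lt (Tuple.monotone_sort v hi') h1
  rw [Fin.card_Iic] at h2
  simp only at h2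
  omega

end Median

/-! ### Blocks of a contaminated sample -/

section Sample

variable {E Ω T : Type*} [MeasurableSpace E] [MeasurableSpace Ω] {P : Measure E}
  [IsProbabilityMeasure P] {μ : Measure Ω}

/-- The values of i.i.d. variables along an injective doubly indexed family are a product sample. -/
lemma hasLaw_blocks {ι : Type*} {X : ι → Ω → E} (hind : iIndepFun X μ)
    (hlaw : ∀ i, HasLaw (X i) P μ) {n b : ℕ} {f : Fin n → Fin b → ι}
    (hf : Function.Injective fun q : Fin n × Fin b => f q.1 q.2) :
    HasLaw (fun ω (l : Fin n) (i : Fin b) => X (f l i) ω)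
      (Measure.pi fun _ => Measure.pi fun _ => P) μ := by
  have h1 := hind.precomp hf
  have hae : ∀ q : Fin n × Fin b, AEMeasurable (X (f q.1 q.2)) μ := fun q => (hlaw _).aemeasurable
  have h2 := h1.map_fun_eq_pi_map hae
  have hpi : HasLaw (fun ω (q : Fin n × Fin b) => X (f q.1 q.2) ω) (Measure.pi fun _ => P) μ :=
    ⟨aemeasurable_pi_lambda _ hae, by
      rw [h2]; congr 1; ext1 q; exact (hlaw _).map_eq⟩
  have hcurry : HasLaw (MeasurableEquiv.curry (Fin n) (Fin b) E)
      (Measure.pi fun _ => Measure.pi fun _ => P) (Measure.pi fun _ : Fin n × Fin b => P) :=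
    ⟨(MeasurableEquiv.curry _ _ _).measurable.aemeasurable, by
      have := Measure.infinitePi_map_curry (fun (_ : Fin n) (_ : Fin b) => P)
      simpa only [Measure.infinitePi_eq_pi] using this⟩
  exact hcurry.comp hpi

/-- Choosing an outlier in each contaminated block is injective, as the blocks are disjoint. -/
lemma card_not_subset_le {N L : ℕ} {In Out : Finset (Fin N)} {B : Fin L → Finset (Fin N)}
    (hcov : In ∪ Out = Finset.univ) (hdisj : ∀ l m, l ≠ m → Disjoint (B l) (B m)) :
    (Finset.univ.filter fun l => ¬ B l ⊆ In).card ≤ Out.card := by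
  classical
  have h : ∀ l, ¬ B l ⊆ In → ∃ i ∈ B l, i ∈ Out := fun l hl => by
    obtain ⟨i, hi, hiIn⟩ := Finset.not_subset.1 hl
    have : i ∈ In ∪ Out := hcov ▸ Finset.mem_univ i
    exact ⟨i, hi, (Finset.mem_union.1 this).resolve_left hiIn⟩
  by_cases hO : Nonempty (Fin N)
  · choose! g hg using h
    refine Finset.card_le_card_of_injOn g (fun l hl => (hg l (by simpa using hl)).2) ?_
    intro l hl m hm hlm
    by_contra hne
    have h1 := (hg l (by simpa using hl)).1
    have h2 := (hg m (by simpa using hm)).1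
    exact Finset.disjoint_left.1 (hdisj l m hne) h1 (hlm ▸ h2)
  · rw [Finset.filter_false_of_mem]
    · simp
    · intro l _ hl
      obtain ⟨i, _⟩ := h l hl
      exact hO ⟨i⟩

/-- With high probability, uniformly over the index set `A`, fewer than half of the blocks have an
average that exceeds the mean by more than `ε`, where blocks with outliers count as bad. -/
theorem measureReal_exists_bad_blocks_le [IsProbabilityMeasure μ] {N L b : ℕ} {X : Fin N → Ω → E} {In Out : Finset (Fin N)}
    {B : Fin L → Finset (Fin N)} (hcov : In ∪ Out = Finset.univ)
    (hind : iIndepFun (fun i : {i // i ∈ In} => X i) μ) (hlaw : ∀ i ∈ In, HasLaw (X i) P μ)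
    (hb : 0 < b) (hL : 0 < L) (hBcard : ∀ l, (B l).card = b)
    (hdisj : ∀ l m, l ≠ m → Disjoint (B l) (B m))
    {ε : ℝ} (hε : 0 < ε) {F : T → E → ℝ} (hF : ∀ t, Measurable (F t)) {K : ℝ} (hK0 : 0 < K)
    (hK : ∀ t x, |F t x| ≤ K) {A : Set T} {S : ℕ → Finset T} (hSA : ∀ m, ∀ t ∈ S m, t ∈ A)
    (hS : ∀ m, (S m).Nonempty) (hS0 : (S 0).card = 1) {d a : ℝ} (hd : 0 < d) (ha : 0 < a)
    (hcard : ∀ m : ℕ, Real.log (S m).card ≤ m * d)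
    (hnet : ∀ m, ∀ t ∈ A, ∃ t' ∈ S m, ∀ x, |F t x - F t' x| ≤ a / 2 ^ m)
    {δ c : ℝ} (hδ : 0 ≤ δ)
    (hc : L * (4 * K / (ε * √b)) + 6 * √(d * (8 * L * a ^ 2 / (ε ^ 2 * b))) ≤ c)
    (hcδ : c + L * δ ≤ L / 2 - Out.card) :
    μ.real {ω | ∃ t ∈ A, ∃ D : Finset (Fin L), L ≤ 2 * D.card ∧ ∀ l ∈ D, B l ⊆ In →
        ε < (∑ i ∈ B l, F t (X i ω)) / b - ∫ x, F t x ∂P} ≤ Real.exp (-2 * L * δ ^ 2) := by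
  classical
  set good : Finset (Fin L) := Finset.univ.filter fun l => B l ⊆ In with hgood
  set n := good.card with hn
  have hL' : (0 : ℝ) < L := by exact_mod_cast hL
  have hc0 : 0 ≤ c := le_trans (by positivity) hc
  have hOut : (Out.card : ℝ) ≤ L / 2 := by nlinarith
  have hsplit : n + (Finset.univ.filter fun l => ¬ B l ⊆ In).card = L := by
    rw [hn, hgood, Finset.card_filter_add_card_filter_not]; simp
  have hbad := card_not_subset_le hcov hdisj
  have hnL : (n : ℝ) ≤ L := by exact_mod_cast (by omega : n ≤ L)
  have hn0 : 0 < n := by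
    have h1 : (L : ℝ) ≤ n + Out.card := by exact_mod_cast (by omega : L ≤ n + Out.card)
    have : (0 : ℝ) < n := by linarith
    exact_mod_cast this
  let e : Fin n ↪o Fin L := good.orderEmbOfFin rfl
  have he : ∀ j, B (e j) ⊆ In := fun j =>
    (Finset.mem_filter.1 (good.orderEmbOfFin_mem rfl j)).2
  let u : ∀ l, Fin b ↪o Fin N := fun l => (B l).orderEmbOfFin (hBcard l)
  have hu : ∀ l i, u l i ∈ B l := fun l i => (B l).orderEmbOfFin_mem (hBcard l) i
  let f : Fin n → Fin b → {i // i ∈ In} := fun j i => ⟨u (e j) i, he j (hu _ i)⟩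
  have hf : Function.Injective fun q : Fin n × Fin b => f q.1 q.2 := by
    rintro ⟨j, i⟩ ⟨j', i'⟩ h
    have h1 : u (e j) i = u (e j') i' := congrArg Subtype.val h
    have h2 : j = j' := by
      by_contra hne
      exact Finset.disjoint_left.1 (hdisj _ _ (e.injective.ne hne)) (hu (e j) i) (h1 ▸ hu (e j') i')
    subst h2
    rw [(u (e j)).injective h1]
  have hY := hasLaw_blocks (μ := μ) (P := P) hind (fun i => hlaw i i.2) hf
  have hsum : ∀ t ω j, blockDev P (F t) (fun i => X (f j i) ω)
      = (∑ i ∈ B (e j), F t (X i ω)) / b - ∫ x, F t x ∂P := by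
    intro t ω j
    unfold blockDev
    congr 2
    rw [← (B (e j)).map_orderEmbOfFin_univ (hBcard (e j)), Finset.sum_map]
    rfl
  -- A net this fine suffices: the block average and the mean each move by at most a/2^m. The
  -- chaining bound does not depend on m.
  obtain ⟨m, hm⟩ : ∃ m : ℕ, 2 * (a / 2 ^ m) ≤ ε / 2 := by
    obtain ⟨m, hm⟩ := pow_unbounded_of_one_lt (4 * a / ε) (one_lt_two : (1 : ℝ) < 2)
    refine ⟨m, ?_⟩
    rw [div_lt_iff₀ hε] at hm
    rw [← mul_div_assoc, div_le_iff₀ (by positivity)]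
    linarith
  have key := measureReal_exists_badCount_le (P := P) hb hn0 hε hF hK0 hK hS hS0 hd ha hcard
    (fun m t ht => hnet m t (hSA _ t ht)) m hnL hδ hc
  have hmeas : MeasurableSet {x : Fin n → Fin b → E |
      c + L * δ ≤ (S m).sup' (hS m) fun t => badCount P ε (F t) x} :=
    measurableSet_le measurable_const
      (measurable_sup'_apply (hS m) fun t => measurable_badCount (hF t))
  -- The event over all of `A` need not be measurable; it is enclosed in a measurable event about
  -- the finite net.
  refine le_trans ?_ key
  rw [← hY.measureReal_eq hmeas]
  refine measureReal_mono ?_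
  rintro ω ⟨t, htA, D, hD, hDε⟩
  obtain ⟨t', ht', htt'⟩ := hnet m t htA
  set A' : Finset (Fin n) := Finset.univ.filter fun j => e j ∈ D with hA'
  have hcount : (A'.card : ℝ) ≤ badCount P ε (F t') (fun j i => X (f j i) ω) := by
    refine card_le_badCount hε _ _ A' fun j hj => ?_
    have h1 := hDε (e j) (Finset.mem_filter.1 hj).2 (he j)
    rw [← hsum] at h1
    have h2 := abs_blockDev_le (P := P) hb htt' (fun i => X (f j i) ω)
    rw [← blockDev_sub (integrable_of_abs_le (hF t) (hK t))
      (integrable_of_abs_le (hF t') (hK t'))] at h2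
    linarith [(abs_le.1 h2).2]
  have hAcard : A'.card = (D.filter fun l => B l ⊆ In).card := by
    rw [← Finset.card_map e.toEmbedding]
    congr 1
    ext l
    simp only [hA', Finset.mem_map, Finset.mem_filter, Finset.mem_univ, true_and]
    constructor
    · rintro ⟨j, hj, rfl⟩; exact ⟨hj, he j⟩
    · rintro ⟨hlD, hl⟩
      have : l ∈ Set.range e := by
        rw [show Set.range e = good from good.range_orderEmbOfFin rfl]
        simpa [hgood] using hl
      obtain ⟨j, rfl⟩ := this
      exact ⟨j, hlD, rfl⟩
  have hDcard : D.card ≤ A'.card + Out.card := by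
    rw [hAcard, ← Finset.card_filter_add_card_filter_not (s := D) (fun l => B l ⊆ In)]
    have : (D.filter fun l => ¬ B l ⊆ In).card ≤ (Finset.univ.filter fun l => ¬ B l ⊆ In).card :=
      Finset.card_le_card (Finset.filter_subset_filter _ (Finset.subset_univ _))
    omega
  have h3 : (L : ℝ) ≤ 2 * (A'.card + Out.card) := by
    exact_mod_cast hD.trans (Nat.mul_le_mul_left 2 hDcard)
  have h4 := Finset.le_sup' (fun t => badCount P ε (F t) (fun j i => X (f j i) ω)) ht'
  show c + L * δ ≤ _
  linarith

end Sample

/-! ### Uniform deviations of the block averages of the clustering loss -/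

section Cluster

variable {k p : ℕ} {M τ H : ℝ} {Ψ : (Fin k → ℝ) → ℝ} {φ : EuclideanSpace ℝ (Fin p) → ℝ}

/-- The loss with sign `s`, cut off outside of the cube. -/
noncomputable def cutLoss (M s : ℝ) (Ψ : (Fin k → ℝ) → ℝ) (φ : EuclideanSpace ℝ (Fin p) → ℝ)
    (Θ : Fin k → EuclideanSpace ℝ (Fin p)) (x : EuclideanSpace ℝ (Fin p)) : ℝ :=
  open Classical in
  if Θ ∈ centroidCube k p M then (cube p M).indicator (fun x => s * clusterLoss Ψ φ Θ x) x else 0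

lemma measurableSet_cube : MeasurableSet (cube p M) := isCompact_cube.measurableSet

lemma cutLoss_eq (s : ℝ) {Θ : Fin k → EuclideanSpace ℝ (Fin p)} (hΘ : Θ ∈ centroidCube k p M)
    {x : EuclideanSpace ℝ (Fin p)} (hx : x ∈ cube p M) :
    cutLoss M s Ψ φ Θ x = s * clusterLoss Ψ φ Θ x := by
  unfold cutLoss
  rw [if_pos hΘ, Set.indicator_of_mem hx]

lemma cutLoss_of_notMem (s : ℝ) (Θ : Fin k → EuclideanSpace ℝ (Fin p))
    {x : EuclideanSpace ℝ (Fin p)} (hx : x ∉ cube p M) : cutLoss M s Ψ φ Θ x = 0 := by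
  unfold cutLoss
  split_ifs
  · rw [Set.indicator_of_notMem hx]
  · rfl

lemma integral_cutLoss {P : Measure (EuclideanSpace ℝ (Fin p))}
    (hP : ∀ᵐ x ∂P, x ∈ cube p M) (s : ℝ) {Θ : Fin k → EuclideanSpace ℝ (Fin p)}
    (hΘ : Θ ∈ centroidCube k p M) :
    ∫ x, cutLoss M s Ψ φ Θ x ∂P = s * clusterRisk Ψ φ P Θ := by
  unfold clusterRisk
  rw [← integral_const_mul]
  refine integral_congr_ae ?_
  filter_upwards [hP] with x hx using cutLoss_eq s hΘ hx

/-- With high probability, uniformly over the centroids in the cube, fewer than half of the blocks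
have an average loss that deviates from the risk by more than `ε` in the direction `s`. -/
theorem measureReal_exists_bad_clustering_le {Ω : Type*} [MeasurableSpace Ω] {μ : Measure Ω}
    [IsProbabilityMeasure μ] {P : Measure (EuclideanSpace ℝ (Fin p))} [IsProbabilityMeasure P]
    (hP : ∀ᵐ x ∂P, x ∈ cube p M) (hM : 0 ≤ M) (hc : ConvexOn ℝ Set.univ φ)
    (hd : Differentiable ℝ φ) (hH : 0 ≤ H)
    (hL : ∀ x ∈ cube p M, ∀ y ∈ cube p M, ‖gradient φ x - gradient φ y‖ ≤ H * ‖x - y‖)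
    (hΨ0 : Ψ 0 = 0) (hτ : 0 ≤ τ)
    (hΨ : ∀ u ∈ Set.Ici (0 : Fin k → ℝ), ∀ v ∈ Set.Ici (0 : Fin k → ℝ),
      |Ψ u - Ψ v| ≤ τ * ∑ j, |u j - v j|)
    {N L b : ℕ} {X : Fin N → Ω → EuclideanSpace ℝ (Fin p)} {In Out : Finset (Fin N)}
    {B : Fin L → Finset (Fin N)} (hcov : In ∪ Out = Finset.univ)
    (hind : iIndepFun (fun i : {i // i ∈ In} => X i) μ) (hlaw : ∀ i ∈ In, HasLaw (X i) P μ)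
    (hb : 0 < b) (hL0 : 0 < L) (hBcard : ∀ l, (B l).card = b)
    (hdisj : ∀ l m, l ≠ m → Disjoint (B l) (B m)) {ε : ℝ} (hε : 0 < ε) {s : ℝ} (hs : |s| = 1)
    {K : ℝ} (hKdef : K = 4 * τ * H * M ^ 2 * (k * p)) (hK0 : 0 < K) {δ c : ℝ} (hδ : 0 ≤ δ)
    (hcε : L * (4 * K / (ε * √b)) + 6 * √((k * p) * (8 * L * K ^ 2 / (ε ^ 2 * b))) ≤ c)
    (hcδ : c + L * δ ≤ L / 2 - Out.card) :
    μ.real {ω | ∃ Θ ∈ centroidCube k p M, ∃ D : Finset (Fin L), L ≤ 2 * D.card ∧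
        ∀ l ∈ D, B l ⊆ In → (∀ i ∈ B l, X i ω ∈ cube p M) ∧
          ε < s * ((∑ i ∈ B l, clusterLoss Ψ φ Θ (X i ω)) / b - clusterRisk Ψ φ P Θ)}
      ≤ Real.exp (-2 * L * δ ^ 2) := by
  have hkp : (0 : ℝ) < k * p := by
    refine lt_of_le_of_ne (by positivity) fun h => ?_
    rw [hKdef, ← h, mul_zero] at hK0
    exact lt_irrefl _ hK0
  choose S hScard hSA hSnet using exists_centroid_net k p hM
  have h0 : (0 : Fin k → EuclideanSpace ℝ (Fin p)) ∈ centroidCube k p M := fun j =>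
    zero_mem_cube hM
  have hSne : ∀ m, (S m).Nonempty := fun m => by
    obtain ⟨t, ht, _⟩ := hSnet m 0 h0
    exact ⟨t, ht⟩
  have hS0 : (S 0).card = 1 :=
    le_antisymm (by simpa using hScard 0) (Finset.card_pos.2 (hSne 0))
  have hlog : ∀ m : ℕ, Real.log (S m).card ≤ m * (k * p : ℝ) := fun m => by
    have h1 : ((S m).card : ℝ) ≤ 2 ^ (m * (k * p)) := by exact_mod_cast hScard m
    have h2 : (0 : ℝ) < (S m).card := by exact_mod_cast (hSne m).card_pos
    -- Since log 2 ≤ 1, the entropy of the m-th net is at most m·kp.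
    refine (Real.log_le_log h2 h1).trans ?_
    rw [Real.log_pow]
    push_cast
    refine mul_le_of_le_one_right (by positivity) ?_
    linarith [Real.log_two_lt_d9]
  have hmeas : ∀ Θ, Measurable (cutLoss M s Ψ φ Θ) := fun Θ => by
    unfold cutLoss
    split_ifs
    · exact ((continuous_clusterLoss hc hd hΨ Θ).measurable.const_mul s).indicator
        measurableSet_cube
    · exact measurable_const
  have hbound : ∀ Θ x, |cutLoss M s Ψ φ Θ x| ≤ K := fun Θ x => by
    by_cases hx : x ∈ cube p M
    · by_cases hΘ : Θ ∈ centroidCube k p M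
      · rw [cutLoss_eq s hΘ hx, abs_mul, hs, one_mul, hKdef]
        exact abs_clusterLoss_le hM hc hd hH hL hΨ0 hΨ hΘ hx
      · unfold cutLoss
        rw [if_neg hΘ, abs_zero]; exact hK0.le
    · rw [cutLoss_of_notMem s Θ hx, abs_zero]; exact hK0.le
  have hnet : ∀ m, ∀ Θ ∈ centroidCube k p M, ∃ Θ' ∈ S m, ∀ x,
      |cutLoss M s Ψ φ Θ x - cutLoss M s Ψ φ Θ' x| ≤ K / 2 ^ m := fun m Θ hΘ => by
    obtain ⟨Θ', hΘ', hdist⟩ := hSnet m Θ hΘ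
    refine ⟨Θ', hΘ', fun x => ?_⟩
    by_cases hx : x ∈ cube p M
    · rw [cutLoss_eq s hΘ hx, cutLoss_eq s (hSA m _ hΘ') hx, ← mul_sub, abs_mul, hs, one_mul]
      refine (abs_clusterLoss_sub_le hM hc hd hH hL hτ hΨ hΘ (hSA m _ hΘ') hx (by positivity)
        hdist).trans (le_of_eq ?_)
      rw [hKdef]; ring
    · rw [cutLoss_of_notMem s Θ hx, cutLoss_of_notMem s Θ' hx, sub_self, abs_zero]
      positivity
  refine le_trans (measureReal_mono ?_) (measureReal_exists_bad_blocks_le (A := centroidCube k p M)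
    hcov hind hlaw hb hL0 hBcard hdisj hε hmeas hK0 hbound hSA hSne hS0 hkp hK0 hlog hnet hδ
    hcε hcδ)
  rintro ω ⟨Θ, hΘ, D, hD, hDε⟩
  refine ⟨Θ, hΘ, D, hD, fun l hl hlIn => ?_⟩
  obtain ⟨hcube, hlt⟩ := hDε l hl hlIn
  rw [integral_cutLoss hP s hΘ, Finset.sum_congr rfl fun i hi => cutLoss_eq s hΘ (hcube i hi),
    ← Finset.mul_sum, mul_div_assoc, ← mul_sub]
  exact hlt

/-- A minimizer of the risk over all centroids is no better than the best centroids in the cube. -/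
lemma exists_centroidCube_clusterRisk_le {P : Measure (EuclideanSpace ℝ (Fin p))}
    [IsProbabilityMeasure P] (hP : ∀ᵐ x ∂P, x ∈ cube p M) (hM : 0 ≤ M)
    (hc : ConvexOn ℝ Set.univ φ) (hd : Differentiable ℝ φ)
    (hpos : ∀ u ∈ Set.Ici (0 : Fin k → ℝ), 0 ≤ Ψ u) (hmono : MonotoneOn Ψ (Set.Ici 0))
    (hΨ : ∀ u ∈ Set.Ici (0 : Fin k → ℝ), ∀ v ∈ Set.Ici (0 : Fin k → ℝ),
      |Ψ u - Ψ v| ≤ τ * ∑ j, |u j - v j|) (Θ : Fin k → EuclideanSpace ℝ (Fin p)) :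
    ∃ Θ' ∈ centroidCube k p M, clusterRisk Ψ φ P Θ' ≤ clusterRisk Ψ φ P Θ := by
  -- The competitor consists of the Bregman projections of the centroids.
  choose q hq hqle using fun j => exists_bregmanDiv_le (M := M) hc hd hM (Θ j)
  refine ⟨q, hq, ?_⟩
  have hcont := continuous_clusterLoss hc hd hΨ Θ
  obtain ⟨C, hC⟩ := isCompact_cube (p := p) (M := M) |>.exists_bound_of_continuousOn
    hcont.continuousOn
  have hint : Integrable (clusterLoss Ψ φ Θ) P :=
    Integrable.of_bound hcont.measurable.aestronglyMeasurable C
      (by filter_upwards [hP] with x hx using hC x hx)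
  refine integral_mono_of_nonneg (ae_of_all _ fun x => hpos _ (bregmanDiv_mem_Ici hc hd q x))
    hint ?_
  filter_upwards [hP] with x hx
  exact hmono (bregmanDiv_mem_Ici hc hd q x) (bregmanDiv_mem_Ici hc hd Θ x)
    fun j => hqle j x hx

end Cluster

/-! ### Calibration of the deviation level and the excess risk bound -/

/-- The choice of the deviation level in terms of the rate. -/
lemma rate_bound {L b d K Q κ nIn R : ℝ} (hL : 0 < L) (hb : 0 < b) (hd : 0 < d) (hQ : 0 < Q)
    (hκ : 0 < κ) (hK : K = 4 * Q * d) (hn : L * b ≤ 2 * nIn)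
    (hR1 : d * √(L / (L * b)) ≤ R) (hR2 : d ^ (3 / 2 : ℝ) * √nIn / (L * b) ≤ R) :
    L * (4 * K / ((200 / κ * Q * R) * √b))
      + 6 * √(d * (8 * L * K ^ 2 / ((200 / κ * Q * R) ^ 2 * b))) ≤ L * κ := by
  have hbs : 0 < √b := Real.sqrt_pos.2 hb
  have hLs : 0 < √L := Real.sqrt_pos.2 hL
  have hds : 0 < √d := Real.sqrt_pos.2 hd
  have h1 : √(L / (L * b)) = 1 / √b := by
    rw [div_mul_cancel_left₀ hL.ne', Real.sqrt_inv, one_div]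
  rw [h1] at hR1
  have hR0 : 0 < R := lt_of_lt_of_le (by positivity) hR1
  have h32 : d ^ (3 / 2 : ℝ) = d * √d := by
    rw [Real.sqrt_eq_rpow, ← Real.rpow_one_add' hd.le (by norm_num)]; norm_num
  rw [h32] at hR2
  set ε := 200 / κ * Q * R with hε
  have hε0 : 0 < ε := by positivity
  have hsq : √(d * (8 * L * K ^ 2 / (ε ^ 2 * b))) = √8 * √d * √L * K / (ε * √b) := by
    have hK0 : 0 ≤ K := by rw [hK]; positivity
    rw [show d * (8 * L * K ^ 2 / (ε ^ 2 * b)) = (8 * d * L) * K ^ 2 / (ε ^ 2 * b) by ring,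
      Real.sqrt_div (by positivity), Real.sqrt_mul (by positivity), Real.sqrt_sq hK0,
      Real.sqrt_mul (by positivity), Real.sqrt_mul (by positivity), Real.sqrt_mul (sq_nonneg ε),
      Real.sqrt_sq hε0.le]
  have h8 : √8 ≤ 3 := by
    rw [Real.sqrt_le_left (by norm_num)]; norm_num
  have h2' : √2 ≤ 3 / 2 := by
    rw [Real.sqrt_le_left (by norm_num)]; norm_num
  have hsn : √L * √b ≤ 3 / 2 * √nIn := by
    rw [← Real.sqrt_mul hL.le]
    refine (Real.sqrt_le_sqrt hn).trans ?_
    rw [Real.sqrt_mul (by norm_num)]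
    exact mul_le_mul_of_nonneg_right h2' (Real.sqrt_nonneg _)
  -- The second branch of the rate controls the chaining term, the first (`hR4`) the mean term.
  -- Together they need 16 + 24·3·(3/2) = 124, within the allowed 200.
  have hR3 : d * √d * (√L * √b) ≤ 3 / 2 * R * (L * b) := by
    rw [div_le_iff₀ (by positivity)] at hR2
    have := mul_le_mul_of_nonneg_left hsn (by positivity : 0 ≤ d * √d)
    linarith
  have hR4 : d ≤ R * √b := by
    rwa [mul_one_div, div_le_iff₀ hbs] at hR1
  have hbb : √b * √b = b := Real.mul_self_sqrt hb.le
  have hR5 : d * √d * √L ≤ 3 / 2 * R * L * √b := by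
    have : d * √d * √L * √b ≤ (3 / 2 * R * L * √b) * √b := by
      calc d * √d * √L * √b = d * √d * (√L * √b) := by ring
        _ ≤ 3 / 2 * R * (L * b) := hR3
        _ = _ := by rw [mul_assoc _ √b, hbb]; ring
    exact le_of_mul_le_mul_right this hbs
  rw [hsq]
  have hsum : L * (4 * K / (ε * √b)) + 6 * (√8 * √d * √L * K / (ε * √b))
      = (16 * Q * L * d + 24 * √8 * Q * (d * √d * √L)) / (ε * √b) := by
    rw [hK]; field_simp; ring
  rw [hsum, div_le_iff₀ (by positivity)]
  have h9 : L * κ * (ε * √b) = 200 * Q * L * R * √b := by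
    rw [hε]; field_simp
  rw [h9]
  have h10 : 16 * Q * L * d ≤ 16 * Q * L * (R * √b) := by gcongr
  have h11 : 24 * √8 * Q * (d * √d * √L) ≤ 24 * 3 * Q * (3 / 2 * R * L * √b) := by gcongr
  have h12 : 0 ≤ Q * L * R * √b := by positivity
  nlinarith

theorem mainTheorem6 (η : ℝ) (hη : 0 < η) :
    -- the constant depends on `η` only
    ∃ C : ℝ, 0 < C ∧
      ∀ (k p n L b : ℕ) (M τ H : ℝ)
        (Ψ : (Fin k → ℝ) → ℝ) (φ : EuclideanSpace ℝ (Fin p) → ℝ)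
        (P : Measure (EuclideanSpace ℝ (Fin p))) [IsProbabilityMeasure P]
        (Ω : Type*) [MeasurableSpace Ω] (μ : Measure Ω) [IsProbabilityMeasure μ]
        (X : Fin n → Ω → EuclideanSpace ℝ (Fin p))
        -- the indices of the inliers and of the outliers
        (In Out : Finset (Fin n))
        (B : Fin L → Finset (Fin n))
        (Θstar : Fin k → EuclideanSpace ℝ (Fin p))
        (Θhat : Ω → Fin k → EuclideanSpace ℝ (Fin p)),
        0 ≤ M →
        -- `φ` is convex and differentiable, with `H`-Lipschitz gradient on the cube
        ConvexOn ℝ Set.univ φ → Differentiable ℝ φ → 0 ≤ H →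
        (∀ x ∈ cube p M, ∀ y ∈ cube p M, ‖gradient φ x - gradient φ y‖ ≤ H * ‖x - y‖) →
        -- on the nonnegative orthant, `Ψ` is nonnegative, componentwise nondecreasing,
        -- zero at zero, and `τ`-Lipschitz for the `ℓ¹` norm
        (∀ u ∈ Set.Ici (0 : Fin k → ℝ), 0 ≤ Ψ u) →
        MonotoneOn Ψ (Set.Ici 0) → Ψ 0 = 0 →
        (∀ u ∈ Set.Ici (0 : Fin k → ℝ), ∀ v ∈ Set.Ici (0 : Fin k → ℝ),
          |Ψ u - Ψ v| ≤ τ * ∑ j, |u j - v j|) →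
        -- `P` is supported on the cube
        P (cube p M) = 1 →
        -- the data are split into inliers, which are i.i.d. with law `P`, and arbitrary outliers
        Disjoint In Out → In ∪ Out = Finset.univ →
        iIndepFun (fun i : {i // i ∈ In} => X i) μ → (∀ i ∈ In, HasLaw (X i) P μ) →
        -- the data are partitioned into `L` blocks of `b` points each
        0 < b → n = L * b →
        (∀ ℓ, (B ℓ).card = b) → (∀ ℓ m, ℓ ≠ m → Disjoint (B ℓ) (B m)) →
        (2 + η) * (Out.card : ℝ) < L →
        -- `Θstar` is a global minimizer of the risk
        (∀ Θ, clusterRisk Ψ φ P Θstar ≤ clusterRisk Ψ φ P Θ) →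
        -- `Θhat` is a minimizer of the median-of-means objective over the cube
        (∀ ω, Θhat ω ∈ centroidCube k p M ∧ ∀ Θ ∈ centroidCube k p M,
          momObjective Ψ φ B (fun i => X i ω) (Θhat ω) ≤
            momObjective Ψ φ B (fun i => X i ω) Θ) →
        1 - 2 * Real.exp (-2 * L * (2 / (4 + η) - (Out.card : ℝ) / L) ^ 2) ≤
          μ.real {ω | |clusterRisk Ψ φ P (Θhat ω) - clusterRisk Ψ φ P Θstar| ≤
            C * M ^ 2 * τ * H *
              max ((k * p : ℝ) * √((L : ℝ) / n))
                ((k * p : ℝ) ^ (3 / 2 : ℝ) * √(In.card : ℝ) / n)} := by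
  -- This is 1/2 - 2/(4+η), the room left for the mean of the supremum: κ + δ = 1/2 - |O|/L exactly.
  set κ := η / (2 * (4 + η)) with hκdef
  have hκ : 0 < κ := by positivity
  refine ⟨400 / κ, by positivity, ?_⟩
  intro k p n L b M τ H Ψ φ P _ Ω _ μ _ X In Out B Θstar Θhat hM hc hd hH hL hpos hmono hΨ0 hΨ hPcube
    hdisjIO hcov hind hlaw hb hnLb hBcard hBdisj hOut hstar hhat
  have hP : ∀ᵐ x ∂P, x ∈ cube p M := by
    rw [← prob_compl_eq_zero_iff measurableSet_cube] at hPcube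
    exact hPcube
  set R := max ((k * p : ℝ) * √((L : ℝ) / n)) ((k * p : ℝ) ^ (3 / 2 : ℝ) * √(In.card : ℝ) / n)
    with hR
  obtain ⟨Θ', hΘ', hΘ'le⟩ :=
    exists_centroidCube_clusterRisk_le hP hM hc hd hpos hmono hΨ Θstar
  -- the risk vanishes if the loss is trivial on the cube
  by_cases hK0 : 0 < 4 * τ * H * M ^ 2 * (k * p)
  swap
  · have hzero : ∀ Θ ∈ centroidCube k p M, clusterRisk Ψ φ P Θ = 0 := fun Θ hΘ => by
      unfold clusterRisk
      refine (integral_congr_ae ?_).trans (integral_zero _ _)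
      filter_upwards [hP] with x hx
      have := abs_clusterLoss_le hM hc hd hH hL hΨ0 hΨ hΘ hx
      exact abs_nonpos_iff.1 (this.trans (not_lt.1 hK0))
    -- `Θstar` may lie outside the cube, so its risk is squeezed through the projected centroids
    -- `Θ'`.
    have hstar0 : clusterRisk Ψ φ P Θstar = 0 :=
      le_antisymm ((hstar Θ').trans (hzero Θ' hΘ').le) ((hzero Θ' hΘ').ge.trans hΘ'le)
    have hrhs : 0 ≤ 400 / κ * M ^ 2 * τ * H * R := by
      -- For k = 0 the sign of τ is not determined, but the rate vanishes.
      rcases Nat.eq_zero_or_pos k with rfl | hk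
      · have : R = 0 := by rw [hR]; norm_num
        rw [this, mul_zero]
      · have : NeZero k := ⟨hk.ne'⟩
        have hτ := lipschitz_const_nonneg hΨ
        have hR0 : 0 ≤ R := le_max_of_le_left (by positivity)
        positivity
    have huniv : {ω | |clusterRisk Ψ φ P (Θhat ω) - clusterRisk Ψ φ P Θstar| ≤
        400 / κ * M ^ 2 * τ * H * R} = Set.univ := by
      refine Set.eq_univ_of_forall fun ω => ?_
      show |clusterRisk Ψ φ P (Θhat ω) - clusterRisk Ψ φ P Θstar| ≤ 400 / κ * M ^ 2 * τ * H * R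
      rw [hzero _ (hhat ω).1, hstar0, sub_zero, abs_zero]
      exact hrhs
    rw [huniv, probReal_univ]
    linarith [Real.exp_pos (-2 * L * (2 / (4 + η) - (Out.card : ℝ) / L) ^ 2)]
  · have hk : 0 < k := by
      rcases Nat.eq_zero_or_pos k with rfl | hk
      · simp at hK0
      · exact hk
    have : NeZero k := ⟨hk.ne'⟩
    have hτ := lipschitz_const_nonneg hΨ
    have hL' : (0 : ℝ) < L := lt_of_le_of_lt (by positivity) hOut
    have hL0 : 0 < L := by exact_mod_cast hL'
    have hb' : (0 : ℝ) < b := by exact_mod_cast hb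
    have hn : (n : ℝ) = L * b := by exact_mod_cast hnLb
    have hkp : (0 : ℝ) < k * p := by
      refine lt_of_le_of_ne (by positivity) fun h => ?_
      rw [← h, mul_zero] at hK0
      exact lt_irrefl _ hK0
    set Q := τ * H * M ^ 2 with hQ
    have hKQ : 4 * τ * H * M ^ 2 * (k * p) = 4 * Q * (k * p) := by rw [hQ]; ring
    have hQ0 : 0 < Q := by
      rw [hKQ] at hK0
      have := pos_of_mul_pos_left hK0 hkp.le
      linarith
    have hIn : (L * b : ℝ) ≤ 2 * In.card := by
      have h1 : In.card + Out.card = n := by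
        rw [← Finset.card_union_of_disjoint hdisjIO, hcov]; simp
      have h2 : (In.card : ℝ) + Out.card = L * b := by rw [← hn]; exact_mod_cast h1
      have h3 : (2 : ℝ) * Out.card ≤ L := by
        have : 0 ≤ η * (Out.card : ℝ) := by positivity
        linarith
      have h4 : (L : ℝ) ≤ L * b := le_mul_of_one_le_right hL'.le (by exact_mod_cast hb)
      linarith
    have hrate := rate_bound (R := R) hL' hb' hkp hQ0 hκ hKQ hIn
      (by rw [hR, ← hn]; exact le_max_left _ _) (by rw [hR, ← hn]; exact le_max_right _ _)
    set ε := 200 / κ * Q * R with hε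
    have hR0 : 0 < R := lt_of_lt_of_le
      (mul_pos hkp (Real.sqrt_pos.2 (by rw [hn]; positivity))) (le_max_left _ _)
    have hε0 : 0 < ε := by positivity
    set δ := 2 / (4 + η) - (Out.card : ℝ) / L with hδdef
    have hδ : 0 ≤ δ := by
      rw [hδdef, sub_nonneg, div_le_div_iff₀ hL' (by positivity)]
      have : 0 ≤ η * (Out.card : ℝ) := by positivity
      nlinarith
    have hcδ : L * κ + L * δ ≤ L / 2 - Out.card := by
      refine le_of_eq ?_
      rw [hκdef, hδdef]
      field_simp
      ring
    have hdev := fun (s : ℝ) (hs : |s| = 1) =>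
      measureReal_exists_bad_clustering_le hP hM hc hd hH hL hΨ0 hτ hΨ hcov hind hlaw hb hL0 hBcard
        hBdisj hε0 hs rfl hK0 hδ hrate hcδ
    have hae : ∀ᵐ ω ∂μ, ∀ i ∈ In, X i ω ∈ cube p M := by
      rw [ae_all_iff]
      intro i
      rw [Filter.eventually_imp_distrib_left]
      intro hi
      have := (hlaw i hi).map_eq ▸ hP
      exact ae_of_ae_map (hlaw i hi).aemeasurable this
    set U := fun s : ℝ => {ω | ∃ Θ ∈ centroidCube k p M, ∃ D : Finset (Fin L), L ≤ 2 * D.card ∧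
        ∀ l ∈ D, B l ⊆ In → (∀ i ∈ B l, X i ω ∈ cube p M) ∧
          ε < s * ((∑ i ∈ B l, clusterLoss Ψ φ Θ (X i ω)) / b - clusterRisk Ψ φ P Θ)} with hU
    set G := {ω | |clusterRisk Ψ φ P (Θhat ω) - clusterRisk Ψ φ P Θstar| ≤
              400 / κ * M ^ 2 * τ * H * R} with hG
    set Z := {ω | ∀ i ∈ In, X i ω ∈ cube p M}ᶜ with hZ
    have hZ0 : μ.real Z = 0 := by
      rw [measureReal_def, show μ Z = 0 from hae, ENNReal.toReal_zero]
    -- `Θhat` is not assumed measurable, so the probability of `G` is bounded below by a covering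
    -- and subadditivity, not by passing to complements.
    have hcover : Set.univ ⊆ G ∪ (U 1 ∪ (U (-1) ∪ Z)) := by
      intro ω _
      by_contra hω
      simp only [Set.mem_union, not_or] at hω
      obtain ⟨hωG, hω1, hω2, hωZ⟩ := hω
      have hcube : ∀ i ∈ In, X i ω ∈ cube p M := not_not.1 hωZ
      apply hωG
      have hup : ∀ Θ ∈ centroidCube k p M,
          momObjective Ψ φ B (fun i => X i ω) Θ ≤ clusterRisk Ψ φ P Θ + ε := fun Θ hΘ => by
        by_contra hlt
        refine hω1 ⟨Θ, hΘ, _, le_two_mul_card_lt_of_lt_finMedian hL0 (not_le.1 hlt),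
          fun l hl hlIn => ⟨fun i hi => hcube i (hlIn hi), ?_⟩⟩
        have := (Finset.mem_filter.1 hl).2
        rw [hBcard] at this
        linarith
      have hlow : ∀ Θ ∈ centroidCube k p M,
          clusterRisk Ψ φ P Θ - ε ≤ momObjective Ψ φ B (fun i => X i ω) Θ := fun Θ hΘ => by
        by_contra hlt
        refine hω2 ⟨Θ, hΘ, _, le_two_mul_card_lt_of_finMedian_lt hL0 (not_le.1 hlt),
          fun l hl hlIn => ⟨fun i hi => hcube i (hlIn hi), ?_⟩⟩
        have := (Finset.mem_filter.1 hl).2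
        rw [hBcard] at this
        linarith
      -- The risk of `Θhat` minus ε is at most its objective, hence at most that of `Θ'`, hence at
      -- most the risk of `Θ'` plus ε, and the risk of `Θ'` is at most that of `Θstar`.
      have h1 := hlow _ (hhat ω).1
      have h2 := (hhat ω).2 Θ' hΘ'
      have h3 := hup Θ' hΘ'
      have h4 : 400 / κ * M ^ 2 * τ * H * R = 2 * ε := by rw [hε, hQ]; ring
      show |clusterRisk Ψ φ P (Θhat ω) - clusterRisk Ψ φ P Θstar| ≤ 400 / κ * M ^ 2 * τ * H * R
      rw [h4, abs_of_nonneg (sub_nonneg.2 (hstar _))]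
      linarith
    have h1 : (1 : ℝ) ≤ μ.real G + (μ.real (U 1) + (μ.real (U (-1)) + μ.real Z)) := by
      refine (probReal_univ (μ := μ)).ge.trans ?_
      refine (measureReal_mono hcover).trans ((measureReal_union_le _ _).trans ?_)
      gcongr
      refine (measureReal_union_le _ _).trans ?_
      gcongr
      exact measureReal_union_le _ _
    have h2 := hdev 1 (by simp)
    have h3 := hdev (-1) (by simp)
    rw [hZ0] at h1
    linarith
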